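/- Let $T$ be a complete theory in a language $\mathcal L$, let $\kappa>|T|=|\mathcal L|+\aleph_0$ be a measurable cardinal, and let $M$ be the saturated model of $T$ of cardinality $\kappa$, an elementary submodel of a ($\kappa^+$-saturated) monster model $\mathbb O$. Types without further specification are global, i.e. complete types over $\mathbb O$; $x,y,z$ denote finite tuples of variables. Definitions. A global type $p(y)$ is $N$-invariant if for all $\psi(y,z)$ and all $d\equiv_N d'$ in $\mathbb O$, $\psi(y,d)\in p\iff\psi(y,d')\in p$. It is $N$-bi-invariant if it is $N$-invariant and, whenever $a\models p{\restriction}Nb$, $\operatorname{tp}(b/Na)$ extends to a global $N$-invariant type; it is strongly $N$-bi-invariant if $p^{\otimes n}$ is $N$-bi-invariant for every $n<\omega$, where $p^{\otimes n}{\restriction}B$ (for small $B\supseteq N$) is the type over $B$ of any $(a_0,\dots,a_{n-1})$ with $a_i\models p{\restriction}Ba_{<i}$. A Morley sequence over $N$ generated by $p$ is $(e_i)_{i<\omega}$ with $e_i\models p{\restriction}Ne_{<i}$, and, for $N$-invariant $p(y)\supseteq\operatorname{tp}(c/N)$, $\varphi(x,c)$ $p$-Kim-divides if $\{\varphi(x,e_i):i<\omega\}$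 is inconsistent for every such sequence. An (indexed) set of formulas is $k$-inconsistent if any $k$ distinct (distinctly indexed) members are jointly inconsistent. A dual type over $M$ is a set $\Gamma(x)$ of formulas with parameters in $M$ that is $k$-inconsistent for some $k<\omega$. A club of small elementary substructures of $M$ is a set $C$ of elementary substructures $N\preceq M$ with $|N|<\kappa$ such that every $A\subseteq M$ with $|A|<\kappa$ is contained in some $N\in C$, and the union of every nonempty chain of fewer than $\kappa$ members of $C$ is in $C$. The class of right-combs in $2^{<\omega}$ is the smallest class of sets that contains all sets with at most one element and contains $X$ whenever there is $\sigma$ such that every element of $X$ properly extends $\sigma$, $X$ has exactly one element extending $\sigma^\frown 0$, and $\{\tau\in X:\tau\trianglerighteq\sigma^\frown 1\}$ is a right-comb. $T$ has CTP (resp. ATP) if for some $k<\omega$ there are a formula $\varphi(x,y)$ and tuples $(b_\sigma)_{\sigma\in2^{<\omega}}$ in a model of $T$ such that $\{\varphi(x,b_{\eta\restriction n}):n<\omega\}$ is $k$-inconsistent for every $\eta\in2^\omega$, while $\{\varphi(x,b_\sigma):\sigma\in X\}$ is consistent for every right-comb (resp. every antichain) $X\subseteq2^{<\omega}$. Statement.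 Let $\Gamma(x)$ be a dual type over $M$ with $|\Gamma|=\kappa$ and let $C$ be a club of small elementary substructures of $M$. (1) Suppose that for every $N\in C$ there are a formula $\varphi_N(x,c_N)\in\Gamma(x)$ with $c_N\notin N$ (meaning that some parameter of $c_N$ that actually occurs in the formula lies outside $N$) and an $N$-bi-invariant type $p_N(y)\supseteq\operatorname{tp}(c_N/N)$ such that $\varphi_N(x,c_N)$ does not $p_N$-Kim-divide. Then $T$ has CTP. (2) Suppose the same with every $p_N$ strongly $N$-bi-invariant. Then $T$ has ATP. (3) Consequently, if $T$ does not have ATP (i.e. is NATP), then there is $N\in C$ such that for every formula $\varphi(x,c)\in\Gamma(x)$ with $c\notin N$ (in the same sense) and every strongly $N$-bi-invariant $p(y)\supseteq\operatorname{tp}(c/N)$, $\varphi(x,c)$ $p$-Kim-divides. -/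

import Mathlib

open FirstOrder Cardinal

universe u v w

/-- A cardinal `κ` is measurable if it is uncountable and there is a nonprincipal `κ`-complete
ultrafilter on a set of cardinality `κ`. -/
def Cardinal.IsMeasurable (κ : Cardinal.{w}) : Prop :=
  ℵ₀ < κ ∧ ∃ U : Ultrafilter κ.out,
    CardinalInterFilter (U : Filter κ.out) κ ∧ ∀ a : κ.out, U ≠ pure a

namespace FirstOrder.Language

variable {L : Language.{u, v}}

section Trees

/-! ### The binary tree `2^{<ω}`, as the set of finite lists of booleans ordered by `<+:` -/

/-- The cone above `σ`: all `τ` extending `σ` (including `σ`). -/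
def cone (σ : List Bool) : Set (List Bool) := {τ | σ <+: τ}

/-- The restriction of a path `η ∈ 2^ω` to its first `n` entries. -/
def pathRestrict (η : ℕ → Bool) (n : ℕ) : List Bool := List.ofFn fun i : Fin n => η i

/-- Right-combs in `2^{<ω}`: the smallest class of sets that contains the sets with at most one
element and contains `X` whenever, for some `σ`, `X` is contained in the cone above `σ` minus `σ`,
`X` has exactly one element above `σ⌢0`, and the part of `X` above `σ⌢1` is in the class. -/
inductive IsRightComb : Set (List Bool) → Prop
  | subsingleton (X : Set (List Bool)) (hX : X.Subsingleton) : IsRightComb X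
  | step (X : Set (List Bool)) (σ : List Bool) (hX : X ⊆ cone σ \ {σ})
      (h0 : ∃ τ, X ∩ cone (σ ++ [false]) = {τ})
      (h1 : IsRightComb (X ∩ cone (σ ++ [true]))) : IsRightComb X

end Trees

section Families

variable {M : Type*} [L.Structure M] {ι α β : Type*}

/-- In the indexed family `{φ(x, b i) : i ∈ ι}`, any `k` members (with distinct indices) are
jointly inconsistent. -/
def IsKInconsistent (φ : L.Formula (α ⊕ β)) (b : ι → β → M) (k : ℕ) : Prop :=
  ∀ F : Finset ι, F.card = k → ¬ ∃ x : α → M, ∀ i ∈ F, φ.Realize (Sum.elim x (b i))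

/-- `{φ(x, b i) : i ∈ X}` is consistent, i.e. finitely satisfiable in `M`. -/
def IsConsistentOn (φ : L.Formula (α ⊕ β)) (b : ι → β → M) (X : Set ι) : Prop :=
  ∀ F : Finset ι, (F : Set ι) ⊆ X → ∃ x : α → M, ∀ i ∈ F, φ.Realize (Sum.elim x (b i))

end Families

section TreeProperties

/-- `T` has `k`-CTP: in some model of `T` there is a binary tree of tuples `b σ` and a formula
`φ(x, y)` which is `k`-inconsistent along every path and consistent on every right-comb. -/
def Theory.HasKCTP (T : L.Theory) (k : ℕ) : Prop :=
  ∃ (𝓜 : Theory.ModelType.{u, v, max u v} T) (m n : ℕ) (φ : L.Formula (Fin m ⊕ Fin n))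
    (b : List Bool → Fin n → 𝓜),
    (∀ η : ℕ → Bool, IsKInconsistent φ (fun i => b (pathRestrict η i)) k) ∧
      ∀ X : Set (List Bool), IsRightComb X → IsConsistentOn φ b X

/-- The comb tree property. -/
def Theory.HasCTP (T : L.Theory) : Prop := ∃ k : ℕ, T.HasKCTP k

/-- `T` has `k`-ATP: in some model of `T` there is a binary tree of tuples `b σ` and a formula
`φ(x, y)` which is `k`-inconsistent along every path and consistent on every antichain. -/
def Theory.HasKATP (T : L.Theory) (k : ℕ) : Prop :=
  ∃ (𝓜 : Theory.ModelType.{u, v, max u v} T) (m n : ℕ) (φ : L.Formula (Fin m ⊕ Fin n))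
    (b : List Bool → Fin n → 𝓜),
    (∀ η : ℕ → Bool, IsKInconsistent φ (fun i => b (pathRestrict η i)) k) ∧
      ∀ X : Set (List Bool), IsAntichain (· <+: ·) X → IsConsistentOn φ b X

/-- The antichain tree property. -/
def Theory.HasATP (T : L.Theory) : Prop := ∃ k : ℕ, T.HasKATP k

end TreeProperties

section Saturation

variable (L)

/-- `M` is `μ`-saturated: for every `A ⊆ M` with `|A| < μ`, every complete type over `A` in
finitely many variables is realized in `M`. -/
def IsSaturated (μ : Cardinal.{w}) (M : Type w) [L.Structure M] [Nonempty M] : Prop :=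
  ∀ A : Set M, #A < μ → ∀ (n : ℕ) (p : (L[[A]].completeTheory M).CompleteType (Fin n)),
    p ∈ (L[[A]].completeTheory M).realizedTypes M (Fin n)

end Saturation

section Parameters

variable {α β P : Type*}

/-- `φ(x, d)`: the formula with parameters in `P` obtained from the `L`-formula `φ(x, y)` by
substituting the parameters `d` for the variables `y`. -/
def Formula.plug (φ : L.Formula (α ⊕ β)) (d : β → P) : L[[P]].Formula α :=
  BoundedFormula.constantsVarsEquiv.symm
    (Formula.relabel (Sum.elim Sum.inr (fun j => Sum.inl (d j)) : α ⊕ β → P ⊕ α) φ)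

/-- The formula `φ(x, d)` defines what it should. -/
theorem Formula.realize_plug {M : Type*} [L.Structure M] (φ : L.Formula (α ⊕ β)) (d : β → M)
    (x : α → M) : (φ.plug d).Realize x ↔ φ.Realize (Sum.elim x d) := by
  unfold Formula.plug Formula.Realize
  rw [← BoundedFormula.realize_constantsVarsEquiv]
  have h : ∀ f : L.BoundedFormula (M ⊕ α) 0, BoundedFormula.constantsVarsEquiv
      (BoundedFormula.constantsVarsEquiv.symm f) = f := fun f =>
    BoundedFormula.constantsVarsEquiv.apply_symm_apply f
  refine Iff.trans (iff_of_eq (congrArg (fun f : L.BoundedFormula (M ⊕ α) 0 =>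
    BoundedFormula.Realize f _ _) (h _))) ?_
  refine Iff.trans (Formula.realize_relabel) ?_
  unfold Formula.Realize
  refine iff_of_eq (congrArg₂ _ ?_ rfl)
  funext s
  cases s <;> rfl

/-- A set `Γ(x)` of formulas with parameters in `M` is a dual type if, for some `k`, any `k`
distinct members of it are jointly inconsistent. -/
def IsDualType {M : Type*} [L.Structure M] (Γ : Set (L[[M]].Formula α)) : Prop :=
  ∃ k : ℕ, ∀ F : Finset (L[[M]].Formula α), (F : Set (L[[M]].Formula α)) ⊆ Γ → F.card = k →
    ¬ ∃ x : α → M, ∀ θ ∈ F, θ.Realize x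

end Parameters

section GlobalTypes

variable (L) (𝕆 : Type w) [L.Structure 𝕆]

/-- A global type in the variables `α`: a complete type over the whole monster model `𝕆`. -/
abbrev GlobalType (α : Type) : Type _ := (L.elementaryDiagram 𝕆).CompleteType α

variable {L} {𝕆} {α : Type}

/-- `ψ(x, d) ∈ p(x)`. -/
def GlobalType.Holds (p : GlobalType L 𝕆 α) {k : ℕ} (ψ : L.Formula (α ⊕ Fin k))
    (d : Fin k → 𝕆) : Prop :=
  Formula.equivSentence (ψ.plug d) ∈ p

/-- `a ⊨ p ↾ B`; equivalently, `p` extends `tp(a/B)`. -/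
def GlobalType.RealizedOver (p : GlobalType L 𝕆 α) (B : Set 𝕆) (a : α → 𝕆) : Prop :=
  ∀ (k : ℕ) (ψ : L.Formula (α ⊕ Fin k)) (d : Fin k → 𝕆), (∀ j, d j ∈ B) →
    (p.Holds ψ d ↔ ψ.Realize (Sum.elim a d))

/-- `d ≡_A d'`: the tuples `d` and `d'` have the same type over `A`. -/
def SameTypeOver (A : Set 𝕆) {k : ℕ} (d d' : Fin k → 𝕆) : Prop :=
  ∀ (l : ℕ) (χ : L.Formula (Fin k ⊕ Fin l)) (a : Fin l → 𝕆), (∀ j, a j ∈ A) →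
    (χ.Realize (Sum.elim d a) ↔ χ.Realize (Sum.elim d' a))

/-- `p` is `A`-invariant: whether `ψ(x, d) ∈ p(x)` depends only on `ψ` and `tp(d/A)`. -/
def GlobalType.IsInvariant (p : GlobalType L 𝕆 α) (A : Set 𝕆) : Prop :=
  ∀ (k : ℕ) (ψ : L.Formula (α ⊕ Fin k)) (d d' : Fin k → 𝕆), SameTypeOver (L := L) A d d' →
    (p.Holds ψ d ↔ p.Holds ψ d')

/-- `p` is `A`-bi-invariant: it is `A`-invariant and whenever `a ⊨ p ↾ A b`, the type `tp(b/A a)`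
extends to a global `A`-invariant type. -/
def GlobalType.IsBiInvariant (p : GlobalType L 𝕆 α) (A : Set 𝕆) : Prop :=
  p.IsInvariant A ∧
    ∀ (a : α → 𝕆) (k : ℕ) (b : Fin k → 𝕆), p.RealizedOver (A ∪ Set.range b) a →
      ∃ r : GlobalType L 𝕆 (Fin k), r.IsInvariant A ∧ r.RealizedOver (A ∪ Set.range a) b

/-- The global type `r(x₀, …, x_{n-1})` is the power `p^{⊗n}` of the `A`-invariant global type `p`:
for every finite tuple `d`, the restriction of `r` to `A d` is the type over `A d` of any
`(a₀, …, a_{n-1})` such that `a i ⊨ p ↾ A d a₀ … a_{i-1}` for each `i < n`. -/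
def GlobalType.IsPower {n : ℕ} (r : GlobalType L 𝕆 (Fin n × α)) (p : GlobalType L 𝕆 α) (A : Set 𝕆) :
    Prop :=
  ∀ (k : ℕ) (ψ : L.Formula ((Fin n × α) ⊕ Fin k)) (d : Fin k → 𝕆),
    r.Holds ψ d ↔ ∃ a : Fin n → α → 𝕆,
      (∀ i, p.RealizedOver (A ∪ Set.range d ∪ ⋃ j < i, Set.range (a j)) (a i)) ∧
        ψ.Realize (Sum.elim (fun ij : Fin n × α => a ij.1 ij.2) d)

/-- `p` is strongly `A`-bi-invariant: `p^{⊗n}` is `A`-bi-invariant for every `n < ω`. -/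
def GlobalType.IsStronglyBiInvariant (p : GlobalType L 𝕆 α) (A : Set 𝕆) : Prop :=
  p.IsInvariant A ∧
    ∀ n : ℕ, ∃ r : GlobalType L 𝕆 (Fin n × α), r.IsPower p A ∧ r.IsBiInvariant A

/-- `(e i)_{i < ω}` is a Morley sequence over `A` generated by `p`: `e i ⊨ p ↾ A e₀ … e_{i-1}`. -/
def GlobalType.IsMorleySequence (p : GlobalType L 𝕆 α) (A : Set 𝕆) (e : ℕ → α → 𝕆) : Prop :=
  ∀ i, p.RealizedOver (A ∪ ⋃ j < i, Set.range (e j)) (e i)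

/-- `φ(x, y)` `p`-Kim-divides, for the `A`-invariant global type `p(y)`: `{φ(x, e i) : i < ω}` is
inconsistent for every Morley sequence `(e i)` over `A` generated by `p`. -/
def GlobalType.KimDivides {β : Type*} (p : GlobalType L 𝕆 α) (A : Set 𝕆)
    (φ : L.Formula (β ⊕ α)) : Prop :=
  ∀ e : ℕ → α → 𝕆, p.IsMorleySequence A e → ¬ IsConsistentOn φ e Set.univ

end GlobalTypes

section Clubs

variable {𝕆 : Type w} [L.Structure 𝕆]

/-- `C` is a club of small elementary substructures of `M` (where small means of cardinality
`< κ`, and `M` and its elementary substructures are given as elementary substructures of `𝕆`):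
it is unbounded, and closed under unions of nonempty chains of length `< κ`. -/
structure IsClubOfSmall (κ : Cardinal.{w}) (M : L.ElementarySubstructure 𝕆)
    (C : Set (L.ElementarySubstructure 𝕆)) : Prop where
  le : ∀ N ∈ C, N ≤ M
  small : ∀ N ∈ C, #N < κ
  unbounded : ∀ A : Set 𝕆, A ⊆ (M : Set 𝕆) → #A < κ → ∃ N ∈ C, A ⊆ (N : Set 𝕆)
  closed : ∀ D : Set (L.ElementarySubstructure 𝕆), D ⊆ C → D.Nonempty → IsChain (· ≤ ·) D →
    #D < κ → ∃ N ∈ C, (N : Set 𝕆) = ⋃ N' ∈ D, (N' : Set 𝕆)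

end Clubs

end FirstOrder.Language

/-! Closing off ω times inside `C` gives one `N ∈ C` that reflects `Γ`: if `φ(x, c) ∈ Γ` and `c`
lies in an `N`-definable set, then that set contains a tuple `c'` from `N` with `φ(x, c') ∈ Γ`
(`IsClubOfSmall.exists_closed`). Fix such an `N`, with the `φ(x, c)` and `p` provided for it. Two
ultrafilters on tuples of `𝕆` now extend `tp(c/N)`. One, `W`, represents the invariant type `p`. The
other, `V`, concentrates on the set `P` of tuples of `N` that give members of `Γ`. Since some
occurring coordinate `c j₀` is outside `N`, `V` forces the `j₀`-th coordinate to differ from every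
element of `𝕆`.

Trees of every finite height are built upwards by adding new roots (`exists_tree`). A tree of height
`d` becomes the left subtree, a conjugate over `N` becomes the right subtree, and the new root
realizes `V` over both. Two properties survive. Combs are Morley sequences of `p`: by bi-invariance,
the conjugate `b'` can be chosen so that short Morley sequences in the left subtree remain Morley
over `N b'` (`exists_conjugate_base`). Ordinary bi-invariance handles one element on the left, which
suffices for right-combs; strong bi-invariance handles any finite number, hence antichains. Chains
look over `N` like sequences from `P` with distinct `j₀`-th coordinates, because each node realizes
`V` over what lies above it (`ApproxBy.cons`).

As `φ` does not `p`-Kim-divide, it is consistent along combs. Along a chain of length `k` it is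
inconsistent, since otherwise `k` distinct members of the dual type `Γ` would be jointly consistent.
Compactness turns the finite trees into an infinite one in a model of `T`. The third claim is the
contrapositive of the second. -/

namespace FirstOrder.Language

variable {L : Language.{u, v}}

/-! ### Definable sets, their fibres, and equality of types over a set. -/

section Definability

variable {M : Type w} [L.Structure M] {α ι : Type*} {A B : Set M}

theorem definable_fiber {R : Set (α ⊕ ι → M)} (hR : A.Definable L R) (hAB : A ⊆ B) {d : ι → M}
    (hd : ∀ i, d i ∈ B) : B.Definable L {x : α → M | Sum.elim x d ∈ R} := by
  obtain ⟨φ, rfl⟩ := Set.definable_iff_exists_formula_sum.1 hR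
  refine Set.definable_iff_exists_formula_sum.2 ⟨φ.relabel
    (Sum.elim (fun a : A => Sum.inl ⟨a, hAB a.2⟩) (Sum.elim Sum.inr fun i => Sum.inl ⟨d i, hd i⟩)), ?_⟩
  ext x
  simp only [Set.mem_ofPred_eq, Formula.realize_relabel]
  refine iff_of_eq (congrArg _ ?_)
  funext i
  rcases i with a | a | i <;> rfl

theorem exists_definable_fiber {d : ι → M} {s : Set (α → M)}
    (hs : (A ∪ Set.range d).Definable L s) :
    ∃ R : Set (α ⊕ ι → M), A.Definable L R ∧ s = {x : α → M | Sum.elim x d ∈ R} := by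
  classical
  obtain ⟨φ, rfl⟩ := Set.definable_iff_exists_formula_sum.1 hs
  have hg : ∀ a : ↥(A ∪ Set.range d), ∃ t : A ⊕ (α ⊕ ι), ∀ x : α → M,
      Sum.elim (fun a : A => (a : M)) (Sum.elim x d) t = a := by
    rintro ⟨a, ha | ⟨i, rfl⟩⟩
    · exact ⟨Sum.inl ⟨a, ha⟩, fun _ => rfl⟩
    · exact ⟨Sum.inr (Sum.inr i), fun _ => rfl⟩
  choose g hg using hg
  refine ⟨_, Set.definable_iff_exists_formula_sum.2
    ⟨φ.relabel (Sum.elim g fun a => Sum.inr (Sum.inl a)), rfl⟩, ?_⟩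
  ext x
  simp only [Set.mem_ofPred_eq, Formula.realize_relabel]
  refine iff_of_eq (congrArg _ ?_)
  funext i
  rcases i with a | a
  · exact (hg a x).symm
  · rfl

theorem definable_formula (φ : L.Formula (α ⊕ ι)) {d : ι → M} (hd : ∀ i, d i ∈ A) :
    A.Definable L {x : α → M | φ.Realize (Sum.elim x d)} :=
  definable_fiber (Set.empty_definable_iff.2 ⟨φ, rfl⟩ : (∅ : Set M).Definable L
    {z : α ⊕ ι → M | φ.Realize z}) (Set.empty_subset A) hd

/-- Only finitely many variables occur in a formula. This brings arbitrary parameter tuples to the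
`Fin k`-indexed form in which global types are queried. -/
theorem Formula.exists_fin_params {β : Type*} (φ : L.Formula (α ⊕ β)) :
    ∃ (k : ℕ) (ψ : L.Formula (α ⊕ Fin k)) (g : Fin k → β),
      ∀ (N : Type w) [L.Structure N] (x : α → N) (z : β → N),
        φ.Realize (Sum.elim x z) ↔ ψ.Realize (Sum.elim x (z ∘ g)) := by
  classical
  let e := (φ.freeVarFinset.toRight).equivFin
  refine ⟨_, φ.restrictFreeVar (fun a => match a with
    | ⟨Sum.inl a, _⟩ => Sum.inl a
    | ⟨Sum.inr b, hb⟩ => Sum.inr (e ⟨b, by simpa using hb⟩)), fun i => e.symm i,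
      fun N _ x z => ?_⟩
  refine (BoundedFormula.realize_restrictFreeVar (Sum.elim x z) ?_).symm
  rintro ⟨a | b, h⟩ <;> simp

theorem definable_iff_exists_params {s : Set (α → M)} : A.Definable L s ↔
    ∃ (k : ℕ) (ψ : L.Formula (α ⊕ Fin k)) (d : Fin k → M),
      (∀ j, d j ∈ A) ∧ s = {x | ψ.Realize (Sum.elim x d)} := by
  constructor
  · intro h
    obtain ⟨φ, rfl⟩ := Set.definable_iff_exists_formula_sum.1 h
    obtain ⟨k, ψ, g, hg⟩ := Formula.exists_fin_params.{u, v, w} (φ.relabel Sum.swap)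
    refine ⟨k, ψ, fun i => g i, fun j => (g j).2, ?_⟩
    ext x
    have := hg M x (fun a : A => (a : M))
    simp only [Formula.realize_relabel] at this
    refine Iff.trans (iff_of_eq (congrArg φ.Realize ?_)) this
    funext i
    rcases i with a | a <;> rfl
  · rintro ⟨k, ψ, d, hd, rfl⟩
    exact definable_formula ψ hd

/-- `a` and `b` lie in the same `A`-definable sets. -/
def SameType (L : Language.{u, v}) {M : Type w} [L.Structure M] (A : Set M) {ι : Type*}
    (a b : ι → M) : Prop :=
  ∀ s : Set (ι → M), A.Definable L s → (a ∈ s ↔ b ∈ s)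

theorem SameType.refl (a : ι → M) : SameType L A a a := fun _ _ => Iff.rfl

theorem SameType.symm {a b : ι → M} (h : SameType L A a b) : SameType L A b a :=
  fun s hs => (h s hs).symm

theorem SameType.mono {a b : ι → M} (h : SameType L B a b) (hAB : A ⊆ B) : SameType L A a b :=
  fun s hs => h s (hs.mono hAB)

theorem SameType.comp {κ : Type*} {a b : ι → M} (h : SameType L A a b) (g : κ → ι) :
    SameType L A (a ∘ g) (b ∘ g) :=
  fun _ hs => h _ (hs.preimage_comp g)

/-- Adjoining the same parameters from `A` on both sides. -/
theorem SameType.sumElim {κ : Type*} {a b : ι → M} (h : SameType L A a b) {d : κ → M}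
    (hd : ∀ i, d i ∈ A) : SameType L A (Sum.elim a d) (Sum.elim b d) :=
  fun _ hs => h _ (definable_fiber hs subset_rfl hd)

theorem SameType.of_imp {a b : ι → M} (h : ∀ s, A.Definable L s → a ∈ s → b ∈ s) :
    SameType L A a b := fun s hs =>
  ⟨h s hs, fun hb => by_contra fun ha => h _ hs.compl ha hb⟩

theorem SameType.sameTypeOver {k : ℕ} {a b : Fin k → M} (h : SameType L A a b) :
    SameTypeOver (L := L) A a b :=
  fun _ χ _ hd => h _ (definable_formula χ hd)

end Definability

/-! ### Types as ultrafilters on tuples, and their realization in saturated models. -/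

section Ultrafilters

variable {𝕆 : Type w} [L.Structure 𝕆] {α : Type}

/-- Every formula of `p` is satisfied in `M`, because the sentence asserting a solution is decided
by the complete theory of `M`. Hence the solution sets generate a proper filter, and completeness of
`p` makes any ultrafilter above it determine `p`. -/
theorem Theory.CompleteType.exists_ultrafilter {M : Type w} [L.Structure M] [Nonempty M] [Finite α]
    (p : (L.completeTheory M).CompleteType α) :
    ∃ W : Ultrafilter (α → M), ∀ θ : L.Formula α,
      Formula.equivSentence θ ∈ p ↔ {x | θ.Realize x} ∈ W := by
  classical
  obtain ⟨𝓜⟩ := p.isMaximal.1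
  let _ : L.Structure 𝓜 := (L.lhomWithConstants α).reduct 𝓜
  have : (L.lhomWithConstants α).IsExpansionOn 𝓜 := LHom.isExpansionOn_reduct _ _
  have hp : ∀ θ : L.Formula α, Formula.equivSentence θ ∈ p ↔
      θ.Realize (fun a => (L.con a : 𝓜)) := by
    intro θ
    rw [← Formula.realize_equivSentence 𝓜 θ]
    refine ⟨fun h => 𝓜.is_model.realize_of_mem _ h, fun h => ?_⟩
    by_contra hn
    exact 𝓜.is_model.realize_of_mem _ ((p.not_mem_iff _).2 hn) h
  have hsat : ∀ θ : L.Formula α, Formula.equivSentence θ ∈ p → ∃ x : α → M, θ.Realize x := by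
    intro θ h
    let χ : L.Sentence := (θ.relabel Sum.inr : L.Formula (Empty ⊕ α)).iExs
    have hχM : M ⊨ χ ↔ ∃ x : α → M, θ.Realize x := by
      simp only [χ, Sentence.Realize, Formula.realize_iExs, Formula.realize_relabel,
        Sum.elim_comp_inr]
    have hχ𝓜 : 𝓜 ⊨ χ ↔ ∃ x : α → 𝓜, θ.Realize x := by
      simp only [χ, Sentence.Realize, Formula.realize_iExs, Formula.realize_relabel,
        Sum.elim_comp_inr]
    by_contra hn
    have h1 : χ.not ∈ L.completeTheory M := fun h' => hn (hχM.1 h')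
    have h2 : 𝓜 ⊨ (L.lhomWithConstants α).onSentence χ.not :=
      𝓜.is_model.realize_of_mem _ (p.subset ⟨_, h1, rfl⟩)
    rw [LHom.realize_onSentence] at h2
    exact h2 (hχ𝓜.2 ⟨_, (hp θ).1 h⟩)
  let F : Filter (α → M) :=
    { sets := {t | ∃ θ : L.Formula α, Formula.equivSentence θ ∈ p ∧ ∀ x, θ.Realize x → x ∈ t}
      univ_sets := ⟨⊤, (hp _).2 (Formula.realize_top.2 trivial), fun _ _ => trivial⟩
      sets_of_superset := fun ⟨θ, h, h'⟩ hst => ⟨θ, h, fun x hx => hst (h' x hx)⟩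
      inter_sets := fun ⟨θ, h, h'⟩ ⟨θ₁, h₁, h₁'⟩ => ⟨θ ⊓ θ₁, (hp _).2
        (Formula.realize_inf.2 ⟨(hp _).1 h, (hp _).1 h₁⟩),
        fun x hx => ⟨h' x (Formula.realize_inf.1 hx).1, h₁' x (Formula.realize_inf.1 hx).2⟩⟩ }
  have hF : F.NeBot := by
    refine ⟨fun h => ?_⟩
    obtain ⟨θ, h, h'⟩ := (Filter.empty_mem_iff_bot.2 h : (∅ : Set (α → M)) ∈ F)
    obtain ⟨x, hx⟩ := hsat θ h
    exact h' x hx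
  refine ⟨Ultrafilter.of F, fun θ => ⟨fun h => Ultrafilter.of_le F ⟨θ, h, fun x hx => hx⟩,
    fun h => ?_⟩⟩
  by_contra hn
  have : {x : α → M | θ.Realize x}ᶜ ∈ F :=
    ⟨θ.not, (hp _).2 (Formula.realize_not.2 fun h' => hn ((hp _).2 h')),
      fun x hx hx' => Formula.realize_not.1 hx hx'⟩
  exact Ultrafilter.compl_mem_iff_notMem.1 (Ultrafilter.of_le F this) h

theorem GlobalType.exists_ultrafilter [Nonempty 𝕆] [Finite α] (p : GlobalType L 𝕆 α) :
    ∃ W : Ultrafilter (α → 𝕆), ∀ (k : ℕ) (ψ : L.Formula (α ⊕ Fin k)) (d : Fin k → 𝕆),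
      p.Holds ψ d ↔ {x | ψ.Realize (Sum.elim x d)} ∈ W := by
  obtain ⟨W, hW⟩ := Theory.CompleteType.exists_ultrafilter p
  refine ⟨W, fun k ψ d => (hW (ψ.plug d)).trans ?_⟩
  simp only [Formula.realize_plug]

theorem exists_realizes_tuple {M : Type w} [L.Structure M] [Nonempty M] {n : ℕ}
    (h : ∀ p : (L.completeTheory M).CompleteType (Fin n),
      p ∈ (L.completeTheory M).realizedTypes M (Fin n))
    {N : Type w} [L.Structure N] [Nonempty N] [N ⊨ L.completeTheory M] (v : Fin n → N) :
    ∃ e : Fin n → M, ∀ θ : L.Formula (Fin n), θ.Realize v → θ.Realize e := by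
  obtain ⟨e, he⟩ := h (Theory.typeOf (L.completeTheory M) v)
  refine ⟨e, fun θ hs => ?_⟩
  have h2 := (Theory.CompleteType.formula_mem_typeOf (T := L.completeTheory M)).2 hs
  rw [← he] at h2
  exact Theory.CompleteType.formula_mem_typeOf.1 h2

/-- In the ultrapower of `M` by `V`, the classes of the coordinate functions realize `V` by Łoś's
theorem; the hypothesis on `M` pulls their type back. -/
theorem exists_realizes_ultrafilter {M : Type w} [L.Structure M] [Nonempty M] {n : ℕ}
    (h : ∀ p : (L.completeTheory M).CompleteType (Fin n),
      p ∈ (L.completeTheory M).realizedTypes M (Fin n)) (V : Ultrafilter (Fin n → M)) :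
    ∃ e : Fin n → M, ∀ θ : L.Formula (Fin n), {x | θ.Realize x} ∈ V → θ.Realize e := by
  let 𝓤 : Type w := (V : Filter (Fin n → M)).Product (fun _ => M)
  let _ : L.Structure 𝓤 := Ultraproduct.structure
  have : Nonempty 𝓤 := Ultraproduct.Product.instNonempty
  have : 𝓤 ⊨ L.completeTheory M := by
    refine ⟨fun θ hθ => ?_⟩
    exact (Ultraproduct.sentence_realize (u := V) (M := fun _ => M) θ).2
      (Filter.Eventually.of_forall fun _ => hθ)
  obtain ⟨e, he⟩ := exists_realizes_tuple h (N := 𝓤) fun i =>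
    ((fun c => c i : (Fin n → M) → M) : (V : Filter (Fin n → M)).Product fun _ => M)
  exact ⟨e, fun θ hs => he θ
    ((Ultraproduct.realize_formula_cast (u := V) (M := fun _ => M) θ (fun i c => c i)).2 hs)⟩

/-- In a saturated model, the restriction of an ultrafilter to the sets definable over a small set
of parameters is realized. -/
theorem IsSaturated.exists_realization [Nonempty 𝕆] {κ : Cardinal.{w}} (h𝕆 : L.IsSaturated κ 𝕆)
    {A : Set 𝕆} (hA : #A < κ) {n : ℕ} (V : Ultrafilter (Fin n → 𝕆)) :
    ∃ e : Fin n → 𝕆, ∀ s, A.Definable L s → s ∈ V → e ∈ s := by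
  obtain ⟨e, he⟩ := exists_realizes_ultrafilter (h𝕆 A hA n) V
  refine ⟨e, ?_⟩
  rintro s ⟨θ, rfl⟩ hs
  exact he θ hs

end Ultrafilters

end FirstOrder.Language

namespace FirstOrder.Language

variable {L : Language.{u, v}}

/-! ### Invariant ultrafilters and finite Morley sequences, listed with the latest term first. -/

section Morley

variable {𝕆 : Type w} [L.Structure 𝕆] {α : Type}

/-- The `A`-invariance of the global type given by the ultrafilter `W`. -/
def UltraInvariant (L : Language.{u, v}) {𝕆 : Type w} [L.Structure 𝕆] {α : Type} (A : Set 𝕆)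
    (W : Ultrafilter (α → 𝕆)) : Prop :=
  ∀ (ι : Type) (R : Set (α ⊕ ι → 𝕆)) (a b : ι → 𝕆), A.Definable L R → SameType L A a b →
    {x | Sum.elim x a ∈ R} ∈ W → {x | Sum.elim x b ∈ R} ∈ W

/-- `e` realizes the restriction to `A` of the global type given by the ultrafilter `W`. -/
def UltraRealizes (L : Language.{u, v}) {𝕆 : Type w} [L.Structure 𝕆] {α : Type}
    (W : Ultrafilter (α → 𝕆)) (A : Set 𝕆) (e : α → 𝕆) : Prop :=
  ∀ s, A.Definable L s → s ∈ W → e ∈ s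

variable {A B : Set 𝕆} {W : Ultrafilter (α → 𝕆)}

theorem UltraRealizes.mem_iff {e : α → 𝕆} (h : UltraRealizes L W A e) {s : Set (α → 𝕆)}
    (hs : A.Definable L s) : e ∈ s ↔ s ∈ W :=
  ⟨fun he => by_contra fun hn =>
    h _ hs.compl (Ultrafilter.compl_mem_iff_notMem.2 hn) he, h s hs⟩

theorem UltraRealizes.mono {e : α → 𝕆} (h : UltraRealizes L W B e) (hAB : A ⊆ B) :
    UltraRealizes L W A e :=
  fun s hs => h s (hs.mono hAB)

theorem UltraRealizes.sameType {e e' : α → 𝕆} (h : UltraRealizes L W A e)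
    (h' : UltraRealizes L W A e') : SameType L A e e' :=
  fun _ hs => (h.mem_iff hs).trans (h'.mem_iff hs).symm

/-- Parameters from `B` are the same on both sides, so they can be absorbed into the tuples being
compared. -/
theorem UltraInvariant.mono (h : UltraInvariant L A W) (hAB : A ⊆ B) : UltraInvariant L B W := by
  intro ι R a b hR hab hW
  obtain ⟨k, ψ, d, hd, rfl⟩ := definable_iff_exists_params.1 hR
  have hψ : A.Definable L {z : α ⊕ (ι ⊕ Fin k) → 𝕆 |
      (ψ.relabel (Equiv.sumAssoc α ι (Fin k))).Realize z} :=
    (Set.empty_definable_iff.2 ⟨_, rfl⟩).mono (Set.empty_subset A)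
  have key : ∀ (x : α → 𝕆) (c : ι → 𝕆),
      (ψ.relabel (Equiv.sumAssoc α ι (Fin k))).Realize (Sum.elim x (Sum.elim c d)) ↔
        ψ.Realize (Sum.elim (Sum.elim x c) d) := by
    intro x c
    rw [Formula.realize_relabel]
    refine iff_of_eq (congrArg ψ.Realize ?_)
    funext i
    rcases i with (i | i) | i <;> rfl
  have := h _ _ _ _ hψ ((hab.sumElim hd).mono hAB) (by simpa only [Set.mem_ofPred_eq, key] using hW)
  simpa only [Set.mem_ofPred_eq, key] using this

theorem GlobalType.IsInvariant.ultraInvariant {p : GlobalType L 𝕆 α} (hp : p.IsInvariant A)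
    (hW : ∀ (k : ℕ) (ψ : L.Formula (α ⊕ Fin k)) (d : Fin k → 𝕆),
      p.Holds ψ d ↔ {x | ψ.Realize (Sum.elim x d)} ∈ W) : UltraInvariant L A W := by
  intro ι R a b hR hab hRW
  obtain ⟨k, ψ, d, hd, rfl⟩ := definable_iff_exists_params.1 hR
  obtain ⟨l, χ, g, hg⟩ :=
    Formula.exists_fin_params.{u, v, w} (ψ.relabel (Equiv.sumAssoc α ι (Fin k)))
  have key : ∀ (x : α → 𝕆) (c : ι → 𝕆), χ.Realize (Sum.elim x (Sum.elim c d ∘ g)) ↔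
        ψ.Realize (Sum.elim (Sum.elim x c) d) := by
    intro x c
    rw [← hg, Formula.realize_relabel]
    refine iff_of_eq (congrArg ψ.Realize ?_)
    funext i
    rcases i with (i | i) | i <;> rfl
  have h1 := (hp l χ _ _ ((hab.sumElim hd).comp g).sameTypeOver).1
    ((hW _ _ _).2 (by simpa only [Set.mem_ofPred_eq, key] using hRW))
  simpa only [Set.mem_ofPred_eq, key] using (hW _ _ _).1 h1

theorem GlobalType.realizedOver_iff {p : GlobalType L 𝕆 α}
    (hW : ∀ (k : ℕ) (ψ : L.Formula (α ⊕ Fin k)) (d : Fin k → 𝕆),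
      p.Holds ψ d ↔ {x | ψ.Realize (Sum.elim x d)} ∈ W) {e : α → 𝕆} :
    p.RealizedOver A e ↔ UltraRealizes L W A e := by
  constructor
  · intro h s hs hsW
    obtain ⟨k, ψ, d, hd, rfl⟩ := definable_iff_exists_params.1 hs
    exact (h k ψ d hd).1 ((hW _ _ _).2 hsW)
  · intro h k ψ d hd
    exact (hW _ _ _).trans (h.mem_iff (definable_formula ψ hd)).symm

/-- All coordinates of a list of tuples. -/
def listCoords (l : List (α → 𝕆)) : Set 𝕆 := {y | ∃ e ∈ l, y ∈ Set.range e}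

theorem listCoords_nil : listCoords ([] : List (α → 𝕆)) = ∅ := by
  simp [listCoords]

theorem listCoords_cons (e : α → 𝕆) (l : List (α → 𝕆)) :
    listCoords (e :: l) = Set.range e ∪ listCoords l := by
  ext y
  simp [listCoords]

theorem listCoords_append (l l' : List (α → 𝕆)) :
    listCoords (l ++ l') = listCoords l ∪ listCoords l' := by
  ext y
  simp [listCoords, or_and_right, exists_or]

theorem listCoords_mono {l l' : List (α → 𝕆)} (h : l ⊆ l') : listCoords l ⊆ listCoords l' :=
  fun _ ⟨e, he, hy⟩ => ⟨e, h he, hy⟩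

theorem listCoords_finite [Finite α] (l : List (α → 𝕆)) : (listCoords l).Finite := by
  induction l with
  | nil => rw [listCoords_nil]; exact Set.finite_empty
  | cons e l ih => rw [listCoords_cons]; exact (Set.finite_range e).union ih

/-- The list `l = [eₖ₋₁, …, e₀]` is a Morley sequence over `A`, in reverse order, in the type given
by `W`. -/
def MorleyList (L : Language.{u, v}) {𝕆 : Type w} [L.Structure 𝕆] {α : Type}
    (W : Ultrafilter (α → 𝕆)) (A : Set 𝕆) : List (α → 𝕆) → Prop
  | [] => True
  | e :: l => UltraRealizes L W (A ∪ listCoords l) e ∧ MorleyList L W A l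

theorem MorleyList.mono {l : List (α → 𝕆)} (h : MorleyList L W B l) (hAB : A ⊆ B) :
    MorleyList L W A l := by
  induction l with
  | nil => trivial
  | cons e l ih => exact ⟨h.1.mono (Set.union_subset_union_left _ hAB), ih h.2⟩

theorem MorleyList.append {l l' : List (α → 𝕆)} (hl : MorleyList L W (A ∪ listCoords l') l)
    (hl' : MorleyList L W A l') : MorleyList L W A (l ++ l') := by
  induction l with
  | nil => exact hl'
  | cons e l ih =>
    refine ⟨?_, ih hl.2⟩
    change UltraRealizes L W (A ∪ listCoords (l ++ l')) e
    rw [listCoords_append]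
    exact hl.1.mono (by intro; simp only [Set.mem_union]; tauto)

theorem MorleyList.drop {l : List (α → 𝕆)} (h : MorleyList L W A l) (i : ℕ) :
    MorleyList L W A (l.drop i) := by
  induction l generalizing i with
  | nil => simpa using h
  | cons e l ih =>
    cases i with
    | zero => exact h
    | succ i => exact ih h.2 i

/-- Moving the first row of a sequence of tuples to the front. -/
def consIndex (α : Type) : ℕ × α → α ⊕ (ℕ × α)
  | (0, j) => Sum.inl j
  | (i + 1, j) => Sum.inr (i, j)

/-- A list of tuples as a sequence of tuples, padded with the constant tuple `o`. -/
def padList (o : 𝕆) : List (α → 𝕆) → ℕ × α → 𝕆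
  | [] => fun _ => o
  | e :: l => Sum.elim e (padList o l) ∘ consIndex α

theorem padList_get (o : 𝕆) (l : List (α → 𝕆)) (i : ℕ) (hi : i < l.length) (j : α) :
    padList o l (i, j) = l[i] j := by
  induction l generalizing i with
  | nil => simp at hi
  | cons e l ih =>
    cases i with
    | zero => rfl
    | succ i => exact ih i (by simpa using hi)

theorem padList_mem (o : 𝕆) (l : List (α → 𝕆)) (i : ℕ × α) :
    padList o l i = o ∨ padList o l i ∈ listCoords l := by
  induction l generalizing i with
  | nil => exact Or.inl rfl
  | cons e l ih =>
    obtain ⟨_ | i, j⟩ := i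
    · exact Or.inr ⟨e, by simp, j, rfl⟩
    · refine (ih (i, j)).imp id fun h => ?_
      rw [listCoords_cons]
      exact Or.inr h

theorem listCoords_subset_range_padList (o : 𝕆) (l : List (α → 𝕆)) :
    listCoords l ⊆ Set.range (padList o l) := by
  rintro _ ⟨e, he, j, rfl⟩
  obtain ⟨i, hi, rfl⟩ := List.getElem_of_mem he
  exact ⟨(i, j), padList_get o l i hi j⟩

variable {o : 𝕆}

/-- Morley sequences of the same length in an invariant type have the same type. -/
theorem MorleyList.sameType (hW : UltraInvariant L A W) (ho : o ∈ A) {l l' : List (α → 𝕆)}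
    (hl : MorleyList L W A l) (hl' : MorleyList L W A l') (hll' : l.length = l'.length) :
    SameType L A (padList o l) (padList o l') := by
  induction l generalizing l' with
  | nil =>
    cases l' with
    | nil => exact SameType.refl _
    | cons e l' => simp at hll'
  | cons e l ih =>
    cases l' with
    | nil => simp at hll'
    | cons e' l' =>
      have h := ih hl.2 hl'.2 (by simpa using hll')
      refine SameType.comp ?_ (consIndex α)
      refine SameType.of_imp fun R hR he => ?_
      have hA : ∀ (l : List (α → 𝕆)) (i : ℕ × α), padList o l i ∈ A ∪ listCoords l := fun l i =>
        (padList_mem o l i).elim (fun h => Or.inl (h.symm ▸ ho)) Or.inr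
      -- Invariance moves the `W`-large fibre over `l` to the fibre over `l'`, where `e'` must lie.
      exact hl'.1 _ (definable_fiber hR Set.subset_union_left (hA l'))
        (hW _ R _ _ hR h
          ((hl.1.mem_iff (definable_fiber hR Set.subset_union_left (hA l))).1 he))

/-- Being a Morley sequence over `A b` only depends on the type over `A` of the sequence and
`b`. -/
theorem MorleyList.of_sameType {ι : Type} (hW : UltraInvariant L A W) (ho : o ∈ A) {b b' : ι → 𝕆}
    {l l' : List (α → 𝕆)} (hll' : l.length = l'.length)
    (h : SameType L A (Sum.elim (padList o l) b) (Sum.elim (padList o l') b'))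
    (hl : MorleyList L W (A ∪ Set.range b) l) : MorleyList L W (A ∪ Set.range b') l' := by
  induction l generalizing l' with
  | nil =>
    cases l' with
    | nil => trivial
    | cons e l' => simp at hll'
  | cons e l ih =>
    cases l' with
    | nil => simp at hll'
    | cons e' l' =>
      have h' : SameType L A (Sum.elim e (Sum.elim (padList o l) b))
          (Sum.elim e' (Sum.elim (padList o l') b')) := by
        let g : α ⊕ ((ℕ × α) ⊕ ι) → (ℕ × α) ⊕ ι :=
          Sum.elim (fun j => Sum.inl (0, j)) (Sum.map (fun i => (i.1 + 1, i.2)) id)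
        have hg : ∀ (e : α → 𝕆) (l : List (α → 𝕆)) (b : ι → 𝕆),
            Sum.elim (padList o (e :: l)) b ∘ g = Sum.elim e (Sum.elim (padList o l) b) := by
          intro e l b
          funext i
          rcases i with i | i | i <;> rfl
        simpa only [hg] using h.comp g
      have ht : SameType L A (Sum.elim (padList o l) b) (Sum.elim (padList o l') b') := by
        simpa only [Sum.elim_comp_inr] using h'.comp Sum.inr
      refine ⟨fun s hs hsW => ?_, ih (by simpa using hll') ht hl.2⟩
      have hsub : A ∪ Set.range b' ∪ listCoords l' ⊆
          A ∪ Set.range (Sum.elim (padList o l') b') := by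
        have := listCoords_subset_range_padList o l'
        rw [Set.Sum.elim_range]
        intro y
        simp only [Set.mem_union]
        rintro ((h | h) | h)
        exacts [Or.inl h, Or.inr (Or.inr h), Or.inr (Or.inl (this h))]
      obtain ⟨R, hR, rfl⟩ := exists_definable_fiber (hs.mono hsub)
      -- The tails together with `b` and `b'` have the same type, so the fibre may be moved back to
      -- the side where `e` is known to be generic.
      have h1 := hW _ R _ _ hR ht.symm hsW
      refine (h' R hR).1 (hl.1 _ (definable_fiber hR ?_ ?_) h1)
      · exact Set.subset_union_left.trans Set.subset_union_left
      · rintro (i | i)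
        · rcases padList_mem o l i with h | h
          · exact Or.inl (Or.inl (by rw [Sum.elim_inl, h]; exact ho))
          · exact Or.inr h
        · exact Or.inl (Or.inr ⟨i, rfl⟩)

theorem MorleyList.of_sameType_padList (hW : UltraInvariant L A W) (ho : o ∈ A)
    {l l' : List (α → 𝕆)} (hll' : l.length = l'.length)
    (h : SameType L A (padList o l) (padList o l'))
    (hl : MorleyList L W A l) : MorleyList L W A l' := by
  have h' := MorleyList.of_sameType (b := Empty.elim) (b' := Empty.elim) hW ho hll'
    (h.sumElim (d := Empty.elim) (fun i => i.elim)) (by rwa [Set.range_eq_empty, Set.union_empty])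
  rwa [Set.range_eq_empty, Set.union_empty] at h'

/-- Conjugating a base away from Morley sequences: if `b` realizes an `A`-invariant type over a
Morley sequence over `A b`, then `b` has a conjugate `b'` over `A` such that all Morley sequences
over `A` in `D` of bounded length are Morley sequences over `A b'`. -/
theorem exists_conjugate_base {k : ℕ} {r : Ultrafilter (Fin k → 𝕆)} (hr : UltraInvariant L A r)
    (hW : UltraInvariant L A W) (ho : o ∈ A) {b : Fin k → 𝕆} {E : List (α → 𝕆)}
    (hE : MorleyList L W (A ∪ Set.range b) E) (hb : UltraRealizes L r (A ∪ listCoords E) b)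
    (D : Set 𝕆)
    (hreal : ∃ b' : Fin k → 𝕆, UltraRealizes L r (A ∪ listCoords E ∪ D) b') :
    ∃ b' : Fin k → 𝕆, SameType L A b b' ∧ ∀ l : List (α → 𝕆), listCoords l ⊆ D →
      l.length ≤ E.length → MorleyList L W A l → MorleyList L W (A ∪ Set.range b') l := by
  obtain ⟨b', hb'⟩ := hreal
  refine ⟨b', (hb.mono Set.subset_union_left).sameType
    (hb'.mono (Set.subset_union_left.trans Set.subset_union_left)), fun l hlD hlE hl => ?_⟩
  -- Dropping from the head discards the latest terms, so an initial segment of the Morley sequence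
  -- `E`, of the length of `l`, remains.
  have hE' := hE.drop (E.length - l.length)
  have hlen : (E.drop (E.length - l.length)).length = l.length := by
    rw [List.length_drop]; omega
  have hsub : listCoords (E.drop (E.length - l.length)) ⊆ listCoords E :=
    listCoords_mono (List.drop_subset _ _)
  generalize E.drop (E.length - l.length) = E' at hE' hlen hsub
  have h1 : SameType L A (padList o E') (padList o l) :=
    (hE'.mono Set.subset_union_left).sameType hW ho hl hlen
  -- Here `E' b ≡ l b'` over `A`: `E'` and `l` have the same type, `r` is invariant, and `b`, `b'`
  -- realize `r` over `E'`, `l` respectively.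
  refine MorleyList.of_sameType hW ho hlen (SameType.of_imp fun R hR hER => ?_) hE'
  have hR' := hR.preimage_comp (Sum.swap : (ℕ × α) ⊕ Fin k → Fin k ⊕ (ℕ × α))
  have key : ∀ (x : Fin k → 𝕆) (y : ℕ × α → 𝕆), Sum.elim x y ∘ Sum.swap = Sum.elim y x := by
    intro x y
    funext i
    rcases i with i | i <;> rfl
  have hpad : ∀ (l : List (α → 𝕆)) (C : Set 𝕆), listCoords l ⊆ C → ∀ i, padList o l i ∈ A ∪ C :=
    fun l C hC i => (padList_mem o l i).elim (fun h => Or.inl (h.symm ▸ ho)) fun h => Or.inr (hC h)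
  have h3 : {x : Fin k → 𝕆 | Sum.elim x (padList o E') ∈
      (fun g => g ∘ Sum.swap) ⁻¹' R} ∈ r :=
    (hb.mem_iff (definable_fiber hR' Set.subset_union_left (hpad E' _ hsub))).1
      (by simpa only [Set.mem_ofPred_eq, Set.mem_preimage, key] using hER)
  have h4 := hb' _ (definable_fiber hR' (Set.subset_union_left.trans Set.subset_union_left)
    (fun i => (hpad l D hlD i).imp Or.inl id)) (hr _ _ _ _ hR' h1 h3)
  simpa only [Set.mem_ofPred_eq, Set.mem_preimage, key] using h4

end Morley

end FirstOrder.Language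

namespace FirstOrder.Language

variable {L : Language.{u, v}}

/-! ### Inductive enumerations of combs and chains, matching the recursive construction of trees. -/

section Lists

/-- Enumerations of right-combs (for `Q t := t ≤ 1`) or of arbitrary finite antichains (for
`Q t := True`) in the binary tree. The predicate `Q` restricts the number of elements branching off
to the left. -/
inductive CombList (Q : ℕ → Prop) : List (List Bool) → Prop
  | nil : CombList Q []
  | root : CombList Q [ [] ]
  | lift (b : Bool) (l : List (List Bool)) (h : CombList Q l) : CombList Q (l.map (b :: ·))
  | pair (l₀ l₁ : List (List Bool)) (h₀ : CombList Q l₀) (h₁ : CombList Q l₁)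
      (hQ : Q l₀.length) : CombList Q (l₀.map (false :: ·) ++ l₁.map (true :: ·))

/-- Increasing enumerations of finite chains in the binary tree. -/
inductive ChainList : List (List Bool) → Prop
  | nil : ChainList []
  | lift (b : Bool) (l : List (List Bool)) (h : ChainList l) : ChainList (l.map (b :: ·))
  | root (b : Bool) (l : List (List Bool)) (h : ChainList l) : ChainList ([] :: l.map (b :: ·))

theorem CombList.length_le {Q : ℕ → Prop} {l : List (List Bool)} (h : CombList Q l) {d : ℕ}
    (hd : ∀ σ ∈ l, σ.length < d) : l.length ≤ 2 ^ d := by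
  induction h generalizing d with
  | nil => simp
  | root => simpa using Nat.one_le_two_pow
  | lift b l h ih =>
    cases d with
    | zero =>
      cases l with
      | nil => simp
      | cons => exact absurd (hd _ List.mem_cons_self) (Nat.not_lt_zero _)
    | succ d =>
      have := ih (d := d) (by simpa using hd)
      rw [List.length_map, pow_succ]
      omega
  | pair l₀ l₁ h₀ h₁ hQ ih₀ ih₁ =>
    cases d with
    | zero =>
      cases l₀ with
      | nil =>
        cases l₁ with
        | nil => simp
        | cons => exact absurd (hd _ List.mem_cons_self) (Nat.not_lt_zero _)
      | cons => exact absurd (hd _ List.mem_cons_self) (Nat.not_lt_zero _)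
    | succ d =>
      have h0 := ih₀ (d := d) fun σ hσ => by simpa using hd (false :: σ) (by simp [hσ])
      have h1 := ih₁ (d := d) fun σ hσ => by simpa using hd (true :: σ) (by simp [hσ])
      rw [List.length_append, List.length_map, List.length_map, pow_succ]
      omega

end Lists

/-! ### Approximating chains by sequences of distinct tuples from a prescribed set. -/

section Approximation

variable {𝕆 : Type w} [L.Structure 𝕆] {α : Type} {A : Set 𝕆}

/-- Every `A`-definable set containing the list `l` of tuples contains a list of tuples from `P`
with pairwise distinct `j₀`-th coordinates. -/
def ApproxBy (L : Language.{u, v}) {𝕆 : Type w} [L.Structure 𝕆] {α : Type} (A : Set 𝕆)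
    (P : Set (α → 𝕆)) (j₀ : α) (o : 𝕆) (l : List (α → 𝕆)) : Prop :=
  ∀ s : Set (ℕ × α → 𝕆), A.Definable L s → padList o l ∈ s →
    ∃ l' : List (α → 𝕆), l'.length = l.length ∧ (∀ c ∈ l', c ∈ P) ∧
      l'.Pairwise (fun c c' => c j₀ ≠ c' j₀) ∧ padList o l' ∈ s

variable {P : Set (α → 𝕆)} {j₀ : α} {o : 𝕆}

theorem ApproxBy.nil : ApproxBy L A P j₀ o [] :=
  fun _ _ h => ⟨[], rfl, by simp, List.Pairwise.nil, h⟩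

theorem ApproxBy.of_sameType {l l' : List (α → 𝕆)} (h : ApproxBy L A P j₀ o l)
    (hl : l.length = l'.length) (hs : SameType L A (padList o l) (padList o l')) :
    ApproxBy L A P j₀ o l' :=
  fun s hsA hls => hl ▸ h s hsA ((hs s hsA).2 hls)

/-- The head is replaced first: since `e` realizes `V` over `A l`, some `c ∈ P` can take its place
with `l` unchanged and `c j₀` new. As `c` has coordinates in `A`, what is then required of the tail
is `A`-definable, and the hypothesis on `l` applies. -/
theorem ApproxBy.cons {V : Ultrafilter (α → 𝕆)} (ho : o ∈ A) (hP : P ∈ V)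
    (hPA : ∀ c ∈ P, ∀ j, c j ∈ A) (hV : ∀ a, {c : α → 𝕆 | c j₀ ≠ a} ∈ V)
    {l : List (α → 𝕆)} (h : ApproxBy L A P j₀ o l) {e : α → 𝕆}
    (he : UltraRealizes L V (A ∪ listCoords l) e) : ApproxBy L A P j₀ o (e :: l) := by
  intro s hs hes
  let R : Set (α ⊕ (ℕ × α) → 𝕆) := (fun g => g ∘ consIndex α) ⁻¹' s
  have hR : A.Definable L R := hs.preimage_comp _
  have h1 : {x : α → 𝕆 | Sum.elim x (padList o l) ∈ R} ∈ V :=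
    (he.mem_iff (definable_fiber hR Set.subset_union_left
      fun i => (padList_mem o l i).elim (fun h => Or.inl (h.symm ▸ ho)) Or.inr)).1 hes
  have h2 : {x : α → 𝕆 | ∀ i ∈ Finset.range l.length, x j₀ ≠ padList o l (i, j₀)} ∈ V := by
    have := (Filter.biInter_finset_mem (f := (V : Filter (α → 𝕆)))
      (s := fun i => {x : α → 𝕆 | x j₀ ≠ padList o l (i, j₀)}) (Finset.range l.length)).2
      fun i _ => hV _
    refine Filter.mem_of_superset this fun x hx i hi => ?_
    exact Set.mem_iInter₂.1 hx i hi
  obtain ⟨c, ⟨hcR, hc⟩, hcP⟩ := V.nonempty_of_mem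
    (Filter.inter_mem (Filter.inter_mem h1 h2) hP)
  -- Besides membership in `s`, the set `t` records that no tail entry repeats `c j₀`, so
  -- distinctness persists when the tail is replaced.
  let t : Set (ℕ × α → 𝕆) := {y | Sum.elim c y ∈ R} ∩
    ⋂ i ∈ Finset.range l.length, {y : ℕ × α → 𝕆 | y (i, j₀) = c j₀}ᶜ
  have hR' := hR.preimage_comp (Sum.swap : α ⊕ (ℕ × α) → (ℕ × α) ⊕ α)
  have ht : A.Definable L t := by
    refine Set.Definable.inter ?_ (Set.definable_biInter_finset (fun i => Set.Definable.compl ?_) _)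
    · convert! definable_fiber hR' subset_rfl (hPA c hcP) using 3 with y
      simp only [Set.mem_preimage]
      refine iff_of_eq (congrArg (· ∈ R) ?_)
      funext i
      rcases i with i | i <;> rfl
    · let θ : L.Formula ((ℕ × α) ⊕ Unit) :=
        Term.equal (Term.var (Sum.inl (i, j₀))) (Term.var (Sum.inr ()))
      have := definable_formula (A := A) θ (d := fun _ => c j₀) fun _ => hPA c hcP j₀
      convert! this using 3
  have hlt : padList o l ∈ t := by
    refine ⟨hcR, Set.mem_iInter₂.2 fun i hi h => hc i hi h.symm⟩
  obtain ⟨l', hl', hl'P, hpw, hl't⟩ := h t ht hlt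
  refine ⟨c :: l', by simpa using hl', by simpa using ⟨hcP, hl'P⟩, ?_, hl't.1⟩
  refine List.pairwise_cons.2 ⟨fun c' hc' hcc' => ?_, hpw⟩
  obtain ⟨i, hi, rfl⟩ := List.getElem_of_mem hc'
  refine Set.mem_iInter₂.1 hl't.2 i (Finset.mem_range.2 (hl' ▸ hi)) ?_
  change padList o l' (i, j₀) = c j₀
  rw [hcc', padList_get o l' i hi]

theorem comp_padList {β γ : Type*} (f : β → γ) (o : β) (l : List (α → β)) :
    f ∘ padList o l = padList (f o) (l.map (f ∘ ·)) := by
  induction l with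
  | nil => rfl
  | cons e l ih =>
    funext i
    obtain ⟨_ | i, j⟩ := i
    · rfl
    · exact congrFun ih (i, j)

theorem SameType.padList_map {ι : Type} {b b' : ι → 𝕆} (h : SameType L A b b') (ho : o ∈ A)
    (l : List (α → ι)) :
    SameType L A (padList o (l.map (b ∘ ·))) (padList o (l.map (b' ∘ ·))) := by
  -- The extra `Unit` coordinate carries the padding value `o`, which is a parameter from `A`.
  have := (h.sumElim (d := fun _ : Unit => o) fun _ => ho).comp
    (padList (Sum.inr ()) (l.map (Sum.inl ∘ ·)))
  rw [comp_padList, comp_padList, List.map_map, List.map_map] at this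
  exact this

end Approximation

/-! ### Inductive construction of the finite trees. -/

section Tree

variable {𝕆 : Type w} [L.Structure 𝕆]

/-- With the levels below `d` read off one finite tuple `b`, replacing `b` by a conjugate `b'`
conjugates the whole tree at once. -/
theorem exists_finite_code {M : Type*} {n : ℕ} (f : List Bool → Fin n → M) (d : ℕ) :
    ∃ (K : ℕ) (t : List Bool → Fin n → Fin K) (b : Fin K → M),
      ∀ σ : List Bool, σ.length < d → f σ = b ∘ t σ := by
  have : Finite {σ : List Bool | σ.length ≤ d} := List.finite_length_le Bool d
  obtain ⟨K, ⟨e⟩⟩ := Finite.exists_equiv_fin ({σ : List Bool | σ.length ≤ d} × Fin n)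
  refine ⟨K, fun σ j => e (⟨σ.take d, by simp⟩, j), fun i => f (e.symm i).1 (e.symm i).2,
    fun σ hσ => ?_⟩
  funext j
  simp [List.take_of_length_le hσ.le]

theorem mk_union_finite_lt {κ : Cardinal.{w}} (hκ : ℵ₀ ≤ κ) {A B : Set 𝕆} (hA : #A < κ)
    (hB : B.Finite) : #(A ∪ B : Set 𝕆) < κ :=
  (mk_union_le A B).trans_lt (add_lt_of_lt hκ hA ((lt_aleph0_iff_set_finite.2 hB).trans_le hκ))

variable {n : ℕ} {A : Set 𝕆} {W V : Ultrafilter (Fin n → 𝕆)} {P : Set (Fin n → 𝕆)} {j₀ : Fin n}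
  {o : 𝕆} {Q : ℕ → Prop}

/-- Trees of finite height `d` whose combs are Morley sequences in `W` and whose chains look like
sequences of distinct elements of `P`. -/
theorem exists_tree [Nonempty 𝕆] {κ : Cardinal.{w}} (hκ : ℵ₀ ≤ κ) (h𝕆 : L.IsSaturated κ 𝕆)
    (hA : #A < κ) (ho : o ∈ A) (hW : UltraInvariant L A W)
    (hVW : ∀ s, A.Definable L s → s ∈ W → s ∈ V) (hP : P ∈ V) (hPA : ∀ c ∈ P, ∀ j, c j ∈ A)
    (hV : ∀ a, {c : Fin n → 𝕆 | c j₀ ≠ a} ∈ V)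
    (hbi : ∀ t : ℕ, ∃ s : ℕ, (∀ i ≤ t, Q i → i ≤ s) ∧ ∀ (k : ℕ) (b : Fin k → 𝕆),
      ∃ E : List (Fin n → 𝕆), E.length = s ∧ MorleyList L W (A ∪ Set.range b) E ∧
        ∃ r : Ultrafilter (Fin k → 𝕆), UltraInvariant L A r ∧
          UltraRealizes L r (A ∪ listCoords E) b) (d : ℕ) :
    ∃ f : List Bool → Fin n → 𝕆,
      (∀ l, CombList Q l → (∀ σ ∈ l, σ.length < d) → MorleyList L W A (l.map f)) ∧
      (∀ l, ChainList l → (∀ σ ∈ l, σ.length < d) → ApproxBy L A P j₀ o (l.map f)) := by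
  induction d with
  | zero =>
    have hnil : ∀ l : List (List Bool), (∀ σ ∈ l, σ.length < 0) → l = [] := by
      intro l hl
      cases l with
      | nil => rfl
      | cons σ l => exact absurd (hl σ (by simp)) (by simp)
    refine ⟨fun _ _ => o, fun l _ hl => ?_, fun l _ hl => ?_⟩
    · rw [hnil l hl]; trivial
    · rw [hnil l hl]; exact ApproxBy.nil
  | succ d ih =>
    obtain ⟨f, hf, hf'⟩ := ih
    obtain ⟨K, t, b, hfb⟩ := exists_finite_code f d
    -- By `CombList.length_le`, a comb on the levels below `d` has at most `2 ^ d` elements.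
    obtain ⟨s, hs, hE⟩ := hbi (2 ^ d)
    obtain ⟨E, rfl, hEb, r, hr, hrb⟩ := hE K b
    obtain ⟨b', hbb', hb'⟩ := exists_conjugate_base hr hW ho hEb hrb (Set.range b)
      (h𝕆.exists_realization (mk_union_finite_lt hκ (mk_union_finite_lt hκ hA (listCoords_finite E))
        (Set.finite_range b)) r)
    obtain ⟨e, he⟩ := h𝕆.exists_realization (mk_union_finite_lt hκ hA
      ((Set.finite_range b).union (Set.finite_range b'))) V
    have hmap : ∀ l : List (List Bool), (∀ σ ∈ l, σ.length < d) →
        l.map f = (l.map t).map (b ∘ ·) := by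
      intro l hl
      rw [List.map_map]
      exact List.map_congr_left fun σ hσ => hfb σ (hl σ hσ)
    have hmap' : ∀ l : List (List Bool),
        l.map (fun σ => b' ∘ t σ) = (l.map t).map (b' ∘ ·) := by
      intro l
      rw [List.map_map]
      rfl
    have hlen : ∀ l : List (List Bool), (l.map f).length = (l.map fun σ => b' ∘ t σ).length := by
      simp
    have hsame : ∀ l : List (List Bool), (∀ σ ∈ l, σ.length < d) →
        SameType L A (padList o (l.map f)) (padList o (l.map fun σ => b' ∘ t σ)) := by
      intro l hl
      rw [hmap l hl, hmap' l]
      exact hbb'.padList_map ho _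
    have hcoord : ∀ l : List (List Bool), (∀ σ ∈ l, σ.length < d) →
        listCoords (l.map f) ⊆ Set.range b := by
      rintro l hl _ ⟨_, hx, j, rfl⟩
      obtain ⟨σ, hσ, rfl⟩ := List.mem_map.1 hx
      exact ⟨t σ j, (congrFun (hfb σ (hl σ hσ)) j).symm⟩
    have hcoord' : ∀ l : List (List Bool),
        listCoords (l.map fun σ => b' ∘ t σ) ⊆ Set.range b' := by
      rintro l _ ⟨_, hx, j, rfl⟩
      obtain ⟨σ, hσ, rfl⟩ := List.mem_map.1 hx
      exact ⟨t σ j, rfl⟩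
    -- Root `e`, the old tree on the left, its conjugate on the right.
    let F : List Bool → Fin n → 𝕆 := fun σ => match σ with
      | [] => e
      | false :: σ => f σ
      | true :: σ => b' ∘ t σ
    have hF0 : ∀ l : List (List Bool), (l.map (false :: ·)).map F = l.map f := by
      intro l
      rw [List.map_map]
      rfl
    have hF1 : ∀ l : List (List Bool),
        (l.map (true :: ·)).map F = l.map fun σ => b' ∘ t σ := by
      intro l
      rw [List.map_map]
      rfl
    have hlt : ∀ (c : Bool) (l : List (List Bool)), (∀ σ ∈ l.map (c :: ·), σ.length < d + 1) →
        ∀ σ ∈ l, σ.length < d := by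
      intro c l h σ hσ
      simpa using h (c :: σ) (List.mem_map_of_mem hσ)
    have hcomb : ∀ (c : Bool) (l : List (List Bool)), CombList Q l → (∀ σ ∈ l, σ.length < d) →
        MorleyList L W A ((l.map (c :: ·)).map F) := by
      intro c l hl hd
      cases c
      · rw [hF0]
        exact hf l hl hd
      · rw [hF1]
        exact (hf l hl hd).of_sameType_padList hW ho (hlen l) (hsame l hd)
    have hchain : ∀ (c : Bool) (l : List (List Bool)), ChainList l → (∀ σ ∈ l, σ.length < d) →
        ApproxBy L A P j₀ o ((l.map (c :: ·)).map F) := by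
      intro c l hl hd
      cases c
      · rw [hF0]
        exact hf' l hl hd
      · rw [hF1]
        exact (hf' l hl hd).of_sameType (hlen l) (hsame l hd)
    refine ⟨F, fun l hl hd => ?_, fun l hl hd => ?_⟩
    · cases hl with
      | nil => trivial
      | root =>
        -- The root realizes `V` rather than `W`, but a comb containing it has no other element, and
        -- `V` and `W` agree over `A`.
        refine ⟨fun s hs hsW => ?_, trivial⟩
        have hs' : A.Definable L s := by
          simpa [listCoords_nil] using hs
        exact he s (hs'.mono Set.subset_union_left) (hVW s hs' hsW)
      | lift c l hl => exact hcomb c l hl (hlt c l hd)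
      | pair l₀ l₁ hl₀ hl₁ hQ =>
        have hd₀ := hlt false l₀ fun σ hσ => hd σ (List.mem_append_left _ hσ)
        have hd₁ := hlt true l₁ fun σ hσ => hd σ (List.mem_append_right _ hσ)
        rw [List.map_append]
        refine MorleyList.append ?_ (hcomb true l₁ hl₁ hd₁)
        rw [hF0, hF1]
        -- The left part continues the right part as a Morley sequence; `Q` bounds its length by
        -- that of `E`, as the choice of `b'` requires.
        refine (hb' _ (hcoord l₀ hd₀) ?_ (hf l₀ hl₀ hd₀)).mono
          (Set.union_subset_union_right _ (hcoord' l₁))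
        rw [List.length_map]
        exact hs _ (hl₀.length_le hd₀) hQ
    · cases hl with
      | nil => exact ApproxBy.nil
      | lift c l hl => exact hchain c l hl (hlt c l hd)
      | root c l hl =>
        have hd' := hlt c l fun σ hσ => hd σ (List.mem_cons_of_mem _ hσ)
        refine (hchain c l hl hd').cons ho hP hPA hV (UltraRealizes.mono he ?_)
        refine Set.union_subset_union_right _ ?_
        cases c
        · rw [hF0]
          exact (hcoord l hd').trans Set.subset_union_left
        · rw [hF1]
          exact (hcoord' l).trans Set.subset_union_right

end Tree

end FirstOrder.Language

namespace FirstOrder.Language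

variable {L : Language.{u, v}}

/-! ### Right-combs, antichains and path segments have the inductive enumerations. -/

section Lists

theorem CombList.map_append {Q : ℕ → Prop} {l : List (List Bool)} (h : CombList Q l)
    (ρ : List Bool) : CombList Q (l.map (ρ ++ ·)) := by
  induction ρ with
  | nil => simpa using h
  | cons b ρ ih =>
    have := CombList.lift b _ ih
    rwa [List.map_map] at this

theorem CombList.exists_of_subsingleton {Q : ℕ → Prop} {X : Set (List Bool)}
    (hX : X.Subsingleton) : ∃ l, CombList Q l ∧ ∀ τ, τ ∈ l ↔ τ ∈ X := by
  rcases hX.eq_empty_or_singleton with rfl | ⟨σ, rfl⟩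
  · exact ⟨[], CombList.nil, by simp⟩
  · exact ⟨_, CombList.root.map_append σ, by simp⟩

/-- The induction must enumerate the part above an arbitrary `ρ`, so that it can be restarted at
`σ⌢1`. If `ρ` is below `σ`, the comb splits at `σ`; if `ρ` is above `σ⌢1`, only the smaller comb
matters; otherwise only the single left element can lie above `ρ`. -/
theorem IsRightComb.exists_combList {X : Set (List Bool)} (hX : IsRightComb X) (ρ : List Bool) :
    ∃ l, CombList (· ≤ 1) l ∧ ∀ τ, τ ∈ l ↔ ρ ++ τ ∈ X := by
  induction hX generalizing ρ with
  | subsingleton X hX =>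
    exact CombList.exists_of_subsingleton (X := {τ | ρ ++ τ ∈ X})
      fun τ h τ' h' => List.append_cancel_left (hX h h')
  | step X σ hX h0 h1 ih =>
    obtain ⟨τ₀, hτ₀⟩ := h0
    have hcases : ∀ τ ∈ X, σ ++ [false] <+: τ ∨ σ ++ [true] <+: τ := by
      intro τ hτ
      obtain ⟨⟨t, rfl⟩, hne⟩ := hX hτ
      cases t with
      | nil => simp at hne
      | cons b t =>
        cases b
        · exact Or.inl ⟨t, by simp⟩
        · exact Or.inr ⟨t, by simp⟩
    by_cases hρσ : ρ <+: σ
    · obtain ⟨σ', rfl⟩ := hρσ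
      obtain ⟨l₁, hl₁, hl₁X⟩ := ih (ρ ++ σ' ++ [true])
      have hτ₀' : ρ ++ σ' ++ [false] <+: τ₀ :=
        (hτ₀.symm ▸ Set.mem_singleton τ₀ : τ₀ ∈ X ∩ cone (ρ ++ σ' ++ [false])).2
      obtain ⟨t₀, rfl⟩ := hτ₀'
      refine ⟨_, (CombList.pair _ l₁ (CombList.root.map_append t₀) hl₁ (by simp)).map_append σ',
        fun τ => ?_⟩
      simp only [List.mem_map, List.mem_append, List.map_cons, List.map_nil, List.append_nil,
        List.mem_singleton]
      constructor
      · rintro ⟨x, rfl | ⟨t, ht, rfl⟩, rfl⟩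
        · have := (hτ₀.symm ▸ Set.mem_singleton _ :
            ρ ++ σ' ++ [false] ++ t₀ ∈ X ∩ cone (ρ ++ σ' ++ [false])).1
          simpa using this
        · simpa using ((hl₁X t).1 ht).1
      · intro hτ
        rcases hcases _ hτ with h | h
        · have : ρ ++ τ ∈ X ∩ cone (ρ ++ σ' ++ [false]) := ⟨hτ, h⟩
          rw [hτ₀, Set.mem_singleton_iff] at this
          refine ⟨_, Or.inl rfl, List.append_cancel_left (as := ρ) ?_⟩
          simpa using this.symm
        · obtain ⟨t, ht⟩ := h
          refine ⟨_, Or.inr ⟨t, (hl₁X t).2 ⟨?_, t, rfl⟩, rfl⟩,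
            List.append_cancel_left (as := ρ) ?_⟩
          · rw [ht]; exact hτ
          · simpa using ht
    by_cases hρ1 : σ ++ [true] <+: ρ
    · obtain ⟨l, hl, hlX⟩ := ih ρ
      refine ⟨l, hl, fun τ => (hlX τ).trans ⟨fun h => h.1, fun h => ⟨h, ?_⟩⟩⟩
      exact hρ1.trans (List.prefix_append _ _)
    refine CombList.exists_of_subsingleton (X := {τ | ρ ++ τ ∈ X}) fun τ h τ' h' => ?_
    have key : ∀ τ, ρ ++ τ ∈ X → ρ ++ τ = τ₀ := by
      intro τ hτ
      rcases hcases _ hτ with h | h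
      · have : ρ ++ τ ∈ X ∩ cone (σ ++ [false]) := ⟨hτ, h⟩
        rwa [hτ₀] at this
      · exfalso
        rcases List.prefix_or_prefix_of_prefix h (List.prefix_append ρ τ) with h' | h'
        · exact hρ1 h'
        · rcases List.prefix_concat_iff.1 h' with h' | h'
          · exact hρ1 (h' ▸ List.prefix_rfl)
          · exact hρσ h'
    exact List.append_cancel_left ((key τ h).trans (key τ' h').symm)

/-- An antichain containing the root is a singleton; any other splits by first bit into two
antichains of smaller height. -/
theorem CombList.exists_of_isAntichain (d : ℕ) (X : Set (List Bool))
    (hd : ∀ σ ∈ X, σ.length < d) (hX : IsAntichain (· <+: ·) X) :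
    ∃ l, CombList (fun _ => True) l ∧ ∀ τ, τ ∈ l ↔ τ ∈ X := by
  induction d generalizing X with
  | zero => exact ⟨[], CombList.nil, fun τ => ⟨by simp, fun h => absurd (hd τ h) (by simp)⟩⟩
  | succ d ih =>
    by_cases hn : [] ∈ X
    · exact CombList.exists_of_subsingleton fun σ hσ τ hτ =>
        (hX.eq hn hσ (List.nil_prefix)).symm.trans (hX.eq hn hτ (List.nil_prefix))
    have key : ∀ b : Bool, ∃ l, CombList (fun _ => True) l ∧ ∀ τ, τ ∈ l ↔ b :: τ ∈ X := by
      intro b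
      refine ih {τ | b :: τ ∈ X} (fun σ hσ => by simpa using hd _ hσ) ?_
      intro σ hσ τ hτ hne hle
      exact hX hσ hτ (by simpa using hne) (List.cons_prefix_cons.2 ⟨rfl, hle⟩)
    obtain ⟨l₀, hl₀, h₀⟩ := key false
    obtain ⟨l₁, hl₁, h₁⟩ := key true
    refine ⟨_, CombList.pair l₀ l₁ hl₀ hl₁ trivial, fun τ => ?_⟩
    rcases τ with _ | ⟨_ | _, τ⟩
    · simpa using hn
    · simpa using h₀ τ
    · simpa using h₁ τ

theorem ChainList.map_pathRestrict (d : ℕ) (η : ℕ → Bool) (l : List ℕ) (hl : l.Pairwise (· < ·))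
    (hd : ∀ i ∈ l, i < d) : ChainList (l.map (pathRestrict η)) := by
  induction d generalizing η l with
  | zero =>
    cases l with
    | nil => exact ChainList.nil
    | cons i l => exact absurd (hd i List.mem_cons_self) (Nat.not_lt_zero _)
  | succ d ih =>
    -- Nodes at positive levels all begin with `η 0`; removing that bit leaves nodes on the shifted
    -- path.
    have hpos : ∀ l : List ℕ, l.Pairwise (· < ·) → (∀ i ∈ l, i < d + 1) → (∀ i ∈ l, 0 < i) →
        ∃ l' : List (List Bool), ChainList l' ∧ l.map (pathRestrict η) = l'.map (η 0 :: ·) := by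
      intro l hl hd h0
      refine ⟨_, ih (fun i => η (i + 1)) (l.map Nat.pred) ?_ ?_, ?_⟩
      · refine List.pairwise_map.2 (hl.imp_of_mem fun {i j} hi hj hij => ?_)
        have := h0 i hi
        simp only [Nat.pred_eq_sub_one]
        omega
      · intro i hi
        obtain ⟨j, hj, rfl⟩ := List.mem_map.1 hi
        have := h0 j hj
        have := hd j hj
        simp only [Nat.pred_eq_sub_one]
        omega
      · rw [List.map_map, List.map_map]
        refine List.map_congr_left fun i hi => ?_
        obtain ⟨j, rfl⟩ := Nat.exists_eq_succ_of_ne_zero (h0 i hi).ne'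
        simp [pathRestrict, List.ofFn_succ]
    cases l with
    | nil => exact ChainList.nil
    | cons i l =>
      rw [List.pairwise_cons] at hl
      rcases Nat.eq_zero_or_pos i with rfl | hi
      · obtain ⟨l', hl', h⟩ := hpos l hl.2 (fun i hi => hd i (List.mem_cons_of_mem _ hi)) hl.1
        rw [List.map_cons, h]
        exact ChainList.root _ _ hl'
      · obtain ⟨l', hl', h⟩ := hpos (i :: l) (List.pairwise_cons.2 hl) hd (by
          intro j hj
          rcases List.mem_cons.1 hj with rfl | hj
          · exact hi
          · exact hi.trans (hl.1 j hj))
        rw [h]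
        exact ChainList.lift _ _ hl'

end Lists

/-! ### From finite trees to an infinite tree. -/

section Compactness

variable {α β ι : Type}

/-- The formula expressing that `{φ(x, y i) : i ∈ F}` is consistent. -/
noncomputable def consistencyFormula [Finite α] (φ : L.Formula (α ⊕ β)) (F : Finset ι) :
    L.Formula (ι × β) :=
  Formula.iExs α (BoundedFormula.iInf fun i : F =>
    (φ.relabel (Sum.elim Sum.inr fun j => Sum.inl (i.1, j)) : L.Formula ((ι × β) ⊕ α)))

theorem realize_consistencyFormula [Finite α] (φ : L.Formula (α ⊕ β)) (F : Finset ι) {M : Type*}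
    [L.Structure M] (y : ι × β → M) : (consistencyFormula φ F).Realize y ↔
      ∃ x : α → M, ∀ i ∈ F, φ.Realize (Sum.elim x fun j => y (i, j)) := by
  rw [consistencyFormula, Formula.realize_iExs]
  refine exists_congr fun x => ?_
  have : ∀ i : ι, (φ.relabel (Sum.elim Sum.inr fun j => Sum.inl (i, j)) :
      L.Formula ((ι × β) ⊕ α)).Realize (Sum.elim y x) ↔
        φ.Realize (Sum.elim x fun j => y (i, j)) := by
    intro i
    rw [Formula.realize_relabel]
    refine iff_of_eq (congrArg φ.Realize ?_)
    funext k
    rcases k with k | k <;> rfl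
  rw [Formula.Realize, BoundedFormula.realize_iInf, Subtype.forall]
  exact forall₂_congr fun i _ => this i

/-- With constants naming the nodes, each requirement is a single sentence. Monotonicity of `X` and
`Y` makes the theories for the various `d` directed, so satisfiability of each gives satisfiability
of their union. -/
theorem exists_model_of_finite_trees {T : L.Theory} {𝕆 : Type w} [L.Structure 𝕆] [Nonempty 𝕆]
    [𝕆 ⊨ T] [Finite α] (φ : L.Formula (α ⊕ β)) (X Y : ℕ → Set (Finset ι)) (hX : Monotone X)
    (hY : Monotone Y)
    (h : ∀ d, ∃ f : ι → β → 𝕆, (∀ F ∈ X d, ∃ x : α → 𝕆, ∀ i ∈ F, φ.Realize (Sum.elim x (f i))) ∧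
      ∀ F ∈ Y d, ¬ ∃ x : α → 𝕆, ∀ i ∈ F, φ.Realize (Sum.elim x (f i))) :
    ∃ (𝓜 : Theory.ModelType.{u, v, max u v} T) (f : ι → β → 𝓜), ∀ d,
      (∀ F ∈ X d, ∃ x : α → 𝓜, ∀ i ∈ F, φ.Realize (Sum.elim x (f i))) ∧
        ∀ F ∈ Y d, ¬ ∃ x : α → 𝓜, ∀ i ∈ F, φ.Realize (Sum.elim x (f i)) := by
  let S : ℕ → L[[ι × β]].Theory := fun d => (L.lhomWithConstants (ι × β)).onTheory T ∪
    ((fun F => Formula.equivSentence (consistencyFormula φ F)) '' X d ∪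
      (fun F => Formula.equivSentence (consistencyFormula φ F).not) '' Y d)
  have hS : Directed (· ⊆ ·) S := Monotone.directed_le fun d d' hd =>
    Set.union_subset_union_right _ (Set.union_subset_union (Set.image_mono (hX hd))
      (Set.image_mono (hY hd)))
  have hsat : Theory.IsSatisfiable (⋃ d, S d) := by
    refine (Theory.isSatisfiable_directed_union_iff hS).2 fun d => ?_
    obtain ⟨f, hf, hf'⟩ := h d
    let _ : (constantsOn (ι × β)).Structure 𝕆 := constantsOn.structure fun i => f i.1 i.2
    have hcon : ∀ i : ι × β, (L.con i : 𝕆) = f i.1 i.2 := fun _ => rfl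
    have hmod : 𝕆 ⊨ S d := by
      refine Theory.model_union_iff.2 ⟨(LHom.onTheory_model _ T).2 inferInstance,
        Theory.model_union_iff.2 ⟨⟨?_⟩, ⟨?_⟩⟩⟩
      · rintro _ ⟨F, hF, rfl⟩
        refine (Formula.realize_equivSentence 𝕆 _).2 ((realize_consistencyFormula φ F _).2 ?_)
        exact hf F hF
      · rintro _ ⟨F, hF, rfl⟩
        refine (Formula.realize_equivSentence 𝕆 _).2 (Formula.realize_not.2 ?_)
        exact fun hx => hf' F hF ((realize_consistencyFormula φ F _).1 hx)
    exact Theory.Model.isSatisfiable 𝕆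
  obtain ⟨𝓝⟩ := hsat
  let _ : L.Structure 𝓝 := (L.lhomWithConstants (ι × β)).reduct 𝓝
  have : (L.lhomWithConstants (ι × β)).IsExpansionOn 𝓝 := LHom.isExpansionOn_reduct _ _
  have hS𝓝 : ∀ d, ∀ θ ∈ S d, 𝓝 ⊨ θ := fun d θ hθ =>
    𝓝.is_model.realize_of_mem θ (Set.mem_iUnion_of_mem d hθ)
  have hT : (𝓝 : Type max u v) ⊨ T := (LHom.onTheory_model (L.lhomWithConstants (ι × β)) T).1
    ⟨fun θ hθ => hS𝓝 0 θ (Or.inl hθ)⟩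
  have hcon : ∀ θ : L.Formula (ι × β), 𝓝 ⊨ Formula.equivSentence θ →
      θ.Realize fun i => (L.con i : 𝓝) := fun θ => (Formula.realize_equivSentence 𝓝 θ).1
  refine ⟨Theory.ModelType.of T 𝓝, fun i j => (L.con (i, j) : 𝓝), fun d => ⟨fun F hF => ?_,
    fun F hF hx => ?_⟩⟩
  · exact (realize_consistencyFormula φ F _).1
      (hcon _ (hS𝓝 d _ (Or.inr (Or.inl ⟨F, hF, rfl⟩))))
  · exact Formula.realize_not.1 (hcon _ (hS𝓝 d _ (Or.inr (Or.inr ⟨F, hF, rfl⟩))))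
      ((realize_consistencyFormula φ F _).2 hx)

end Compactness

end FirstOrder.Language

namespace FirstOrder.Language

variable {L : Language.{u, v}}

/-! ### Recovering parameters from a formula. -/

section Plug

variable {α β γ P : Type*}

theorem Term.eq_of_relabel_eq [DecidableEq α] {γ' : Type*} {f f' : α ⊕ γ → γ'}
    (t : L.Term (α ⊕ γ)) (h : t.relabel f = t.relabel f') {a : α} (ha : a ∈ t.varFinsetLeft) :
    f (Sum.inl a) = f' (Sum.inl a) := by
  induction t with
  | var i =>
    rcases i with i | i
    · simp only [Term.varFinsetLeft, Finset.mem_singleton] at ha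
      subst ha
      simpa [Term.relabel] using h
    · simp [Term.varFinsetLeft] at ha
  | func F ts ih =>
    simp only [Term.varFinsetLeft, Finset.mem_biUnion, Finset.mem_univ, true_and] at ha
    obtain ⟨i, hi⟩ := ha
    simp only [Term.relabel, Term.func.injEq, heq_eq_eq, true_and] at h
    exact ih i (congrFun h i) hi

theorem BoundedFormula.eq_of_relabel_eq [DecidableEq α] {m : ℕ} {g g' : α → β ⊕ Fin m} {k : ℕ}
    (φ : L.BoundedFormula α k) (h : φ.relabel g = φ.relabel g') {a : α}
    (ha : a ∈ φ.freeVarFinset) : g a = g' a := by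
  have key : ∀ k, relabelAux g k (Sum.inl a) = relabelAux g' k (Sum.inl a) → g a = g' a := by
    intro k h
    have h' : (Sum.map id finSumFinEquiv) ((Equiv.sumAssoc β (Fin m) (Fin k)) (Sum.inl (g a))) =
      (Sum.map id finSumFinEquiv) ((Equiv.sumAssoc β (Fin m) (Fin k)) (Sum.inl (g' a))) := h
    exact Sum.inl_injective ((Equiv.sumAssoc β (Fin m) (Fin k)).injective
      ((Function.Injective.sumMap Function.injective_id finSumFinEquiv.injective) h'))
  induction φ with
  | falsum => simp [freeVarFinset] at ha
  | equal t₁ t₂ =>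
    simp only [relabel, mapTermRel, equal.injEq] at h
    simp only [freeVarFinset, Finset.mem_union] at ha
    rcases ha with ha | ha
    · exact key _ (t₁.eq_of_relabel_eq h.1 ha)
    · exact key _ (t₂.eq_of_relabel_eq h.2 ha)
  | rel R ts =>
    simp only [relabel, mapTermRel, rel.injEq, heq_eq_eq, true_and] at h
    simp only [freeVarFinset, Finset.mem_biUnion, Finset.mem_univ, true_and] at ha
    obtain ⟨i, hi⟩ := ha
    exact key _ ((ts i).eq_of_relabel_eq (congrFun h i) hi)
  | imp φ ψ ih₁ ih₂ =>
    simp only [relabel_imp, imp.injEq] at h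
    simp only [freeVarFinset, Finset.mem_union] at ha
    exact ha.elim (ih₁ h.1) (ih₂ h.2)
  | all φ ih =>
    simp only [relabel_all, all.injEq] at h
    exact ih h ha

/-- Dual types speak of distinct formulas, whereas the construction yields tuples with distinct
`j₀`-th coordinates. These give distinct formulas because the variable `j₀` occurs. -/
theorem Formula.eq_of_plug_eq [DecidableEq (α ⊕ β)] {φ : L.Formula (α ⊕ β)} {c c' : β → P}
    (h : φ.plug c = φ.plug c') {j : β} (hj : Sum.inr j ∈ BoundedFormula.freeVarFinset φ) :
    c j = c' j := by
  have h1 := BoundedFormula.eq_of_relabel_eq (m := 0) φ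
    (BoundedFormula.constantsVarsEquiv.symm.injective h) hj
  simpa using h1

end Plug

/-! ### A member of the club that reflects the dual type. -/

section Club

theorem card_formula_le {α : Type} [Finite α] {κ : Cardinal.{max u v w}} (hκ : ℵ₀ ≤ κ)
    (hL : Cardinal.lift.{w} L.card ≤ κ) : Cardinal.lift.{w} #(L.Formula α) ≤ κ := by
  have h1 : #(L.Formula α) ≤ #(Σ n, L.BoundedFormula α n) :=
    Cardinal.mk_le_of_injective (f := fun φ : L.Formula α => ⟨0, φ⟩) fun φ ψ h => by simpa using h
  refine (Cardinal.lift_le.2 (h1.trans BoundedFormula.card_le)).trans ?_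
  rw [Cardinal.lift_max, Cardinal.lift_aleph0, Cardinal.lift_add]
  refine max_le hκ (Cardinal.add_le_of_le hκ ?_ ?_)
  · simp only [Cardinal.lift_lift]
    refine le_trans ?_ hκ
    simp
  · simpa only [Cardinal.lift_uzero] using hL

variable {𝕆 : Type w} [L.Structure 𝕆]

/-- A small set containing witnesses for all formulas with parameters in a given small set. -/
theorem exists_witnesses {κ : Cardinal.{w}} (hκ : ℵ₀ < κ)
    (hL : Cardinal.lift.{w} L.card < Cardinal.lift.{max u v} κ) {A : Set 𝕆} (hA : #A < κ)
    {α : Type} [Finite α] {M : Set 𝕆}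
    (G : ∀ n : ℕ, L.Formula (α ⊕ Fin n) → Set (Fin n → 𝕆))
    (hG : ∀ n φ, ∀ c ∈ G n φ, ∀ j, c j ∈ M) :
    ∃ B ⊆ M, #B < κ ∧ ∀ n φ s, A.Definable L s → (∃ c ∈ G n φ, c ∈ s) →
      ∃ c ∈ G n φ, c ∈ s ∧ ∀ j, c j ∈ B := by
  classical
  let J := Σ n k : ℕ, L.Formula (α ⊕ Fin n) × L.Formula (Fin n ⊕ Fin k) × (Fin k → A)
  let p : (j : J) → (Fin j.1 → 𝕆) → Prop := fun j c =>
    c ∈ G j.1 j.2.2.1 ∧ j.2.2.2.1.Realize (Sum.elim c fun i => (j.2.2.2.2 i : 𝕆))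
  let J' := {j : J // ∃ c, p j c}
  let F : (Σ j : J', Fin j.1.1) → 𝕆 := fun x => x.1.2.choose x.2
  refine ⟨Set.range F, ?_, ?_, ?_⟩
  · rintro _ ⟨⟨j, i⟩, rfl⟩
    exact hG _ _ _ j.2.choose_spec.1 i
  -- One infinite cardinal `ν < κ` bounds the formulas and the tuples from `A`, hence all the
  -- triples being witnessed.
  · let ν : Cardinal.{max u v w} := max ℵ₀ (max (Cardinal.lift.{w} L.card)
      (Cardinal.lift.{max u v} #A))
    have hν0 : ℵ₀ ≤ ν := le_max_left _ _
    have hν : ν < Cardinal.lift.{max u v} κ := by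
      refine max_lt ?_ (max_lt hL (Cardinal.lift_lt.2 hA))
      simpa using (Cardinal.lift_lt.{w, max u v}).2 hκ
    have hL' : Cardinal.lift.{w} L.card ≤ ν := (le_max_left _ _).trans (le_max_right _ _)
    have hA' : Cardinal.lift.{max u v} #A ≤ ν := (le_max_right _ _).trans (le_max_right _ _)
    have hsum : ∀ f : ℕ → Type (max u v w), (∀ i, #(f i) ≤ ν) → #(Σ i, f i) ≤ ν := by
      intro f hf
      rw [Cardinal.mk_sigma]
      refine (Cardinal.sum_le_sum _ _ hf).trans ?_
      rw [Cardinal.sum_const]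
      simpa using Cardinal.mul_le_of_le hν0 hν0 le_rfl
    have hJ : #J ≤ ν := by
      refine hsum _ fun n => hsum _ fun k => ?_
      have hform : ∀ (β : Type) [Finite β],
          Cardinal.lift.{max u v w} #(L.Formula β) ≤ ν := by
        intro β _
        rw [Cardinal.lift_umax.{max u v, w}]
        exact card_formula_le hν0 hL'
      have hpow : Cardinal.lift.{max u v} #(Fin k → A) ≤ ν := by
        have : #(Fin k → A) ≤ max #A ℵ₀ := by
          simpa using Cardinal.power_nat_le_max (c := #A) (n := k)
        refine (Cardinal.lift_le.2 this).trans ?_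
        rw [Cardinal.lift_max, Cardinal.lift_aleph0]
        exact max_le hA' hν0
      simp only [Cardinal.mk_prod, Cardinal.lift_mul, Cardinal.lift_lift]
      exact Cardinal.mul_le_of_le hν0 (hform _) (Cardinal.mul_le_of_le hν0 (hform _) hpow)
    have hF : Cardinal.lift.{max u v} #(Set.range F) ≤ ν := by
      have hr := Cardinal.mk_range_le_lift (f := F)
      rw [Cardinal.lift_id'.{w, max u v w}, Cardinal.lift_umax.{w, max u v}] at hr
      refine hr.trans ?_
      rw [Cardinal.mk_sigma]
      refine (Cardinal.sum_le_sum _ (fun _ => ℵ₀) fun _ => Cardinal.mk_le_aleph0).trans ?_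
      rw [Cardinal.sum_const]
      refine Cardinal.mul_le_of_le hν0 ?_ (by simpa using hν0)
      simpa using (Cardinal.mk_subtype_le _).trans hJ
    exact Cardinal.lift_lt.{w, max u v}.1 (hF.trans_lt hν)
  · rintro n φ s hs ⟨c, hc, hcs⟩
    obtain ⟨k, ψ, d, hd, rfl⟩ := definable_iff_exists_params.1 hs
    let j : J' := ⟨⟨n, k, φ, ψ, fun i => ⟨d i, hd i⟩⟩, c, hc, hcs⟩
    exact ⟨j.2.choose, j.2.choose_spec.1, j.2.choose_spec.2, fun i => ⟨⟨j, i⟩, rfl⟩⟩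

/-- Take an increasing ω-chain in `C`, each member containing the witnesses for its predecessor. The
union is in `C`, and a set definable over it uses finitely many parameters, so it is already
definable over some member of the chain. -/
theorem IsClubOfSmall.exists_closed {κ : Cardinal.{w}} (hκ : ℵ₀ < κ)
    (hL : Cardinal.lift.{w} L.card < Cardinal.lift.{max u v} κ) {M : L.ElementarySubstructure 𝕆}
    {C : Set (L.ElementarySubstructure 𝕆)} (hC : IsClubOfSmall κ M C) {α : Type} [Finite α]
    (G : ∀ n : ℕ, L.Formula (α ⊕ Fin n) → Set (Fin n → 𝕆))
    (hG : ∀ n φ, ∀ c ∈ G n φ, ∀ j, c j ∈ M) :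
    ∃ N ∈ C, ∀ n φ s, (N : Set 𝕆).Definable L s → (∃ c ∈ G n φ, c ∈ s) →
      ∃ c ∈ G n φ, c ∈ s ∧ ∀ j, c j ∈ N := by
  have hstep : ∀ N : C, ∃ N' : C, (N : L.ElementarySubstructure 𝕆) ≤ N' ∧
      ∀ n φ s, ((N : L.ElementarySubstructure 𝕆) : Set 𝕆).Definable L s → (∃ c ∈ G n φ, c ∈ s) →
        ∃ c ∈ G n φ, c ∈ s ∧ ∀ j, c j ∈ (N' : L.ElementarySubstructure 𝕆) := by
    rintro ⟨N, hN⟩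
    obtain ⟨B, hBM, hB, h⟩ := exists_witnesses hκ hL (A := (N : Set 𝕆)) (hC.small N hN)
      (M := (M : Set 𝕆)) G hG
    obtain ⟨N', hN', hBN'⟩ := hC.unbounded ((N : Set 𝕆) ∪ B)
      (Set.union_subset (hC.le N hN) hBM)
      ((mk_union_le _ _).trans_lt (add_lt_of_lt hκ.le (hC.small N hN) hB))
    refine ⟨⟨N', hN'⟩, fun x hx => hBN' (Or.inl hx), fun n φ s hs hc => ?_⟩
    obtain ⟨c, hc, hcs, hcB⟩ := h n φ s hs hc
    exact ⟨c, hc, hcs, fun j => hBN' (Or.inr (hcB j))⟩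
  choose S hS hS' using hstep
  obtain ⟨N₀, hN₀, -⟩ := hC.unbounded ∅ (Set.empty_subset _)
    (by simpa using Cardinal.aleph0_pos.trans hκ)
  let f : ℕ → C := fun i => S^[i] ⟨N₀, hN₀⟩
  have hf : ∀ i, f (i + 1) = S (f i) := fun i => Function.iterate_succ_apply' S i _
  have hmono : Monotone fun i => (f i : L.ElementarySubstructure 𝕆) :=
    monotone_nat_of_le_succ fun i => by rw [hf]; exact hS (f i)
  obtain ⟨N, hN, hNU⟩ := hC.closed (Set.range fun i => (f i : L.ElementarySubstructure 𝕆))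
    (by rintro _ ⟨i, rfl⟩; exact (f i).2) (Set.range_nonempty _) hmono.isChain_range
    ((Set.countable_range _).le_aleph0.trans_lt hκ)
  rw [Set.biUnion_range] at hNU
  refine ⟨N, hN, fun n φ s hs hc => ?_⟩
  obtain ⟨k, ψ, d, hd, rfl⟩ := definable_iff_exists_params.1 hs
  have hd' : ∀ j, ∃ i, d j ∈ (f i : L.ElementarySubstructure 𝕆) := by
    intro j
    have := hd j
    rw [hNU] at this
    exact Set.mem_iUnion.1 this
  choose i hi using hd'
  obtain ⟨b, hb⟩ := (Set.finite_range i).bddAbove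
  obtain ⟨c, hc, hcs, hcN⟩ := hS' (f b) n φ _
    (definable_formula ψ fun j => hmono (hb ⟨j, rfl⟩) (hi j)) hc
  refine ⟨c, hc, hcs, fun j => ?_⟩
  have : c j ∈ (N : Set 𝕆) := by
    rw [hNU]
    refine Set.mem_iUnion.2 ⟨b + 1, ?_⟩
    rw [hf]
    exact hcN j
  exact this

end Club

end FirstOrder.Language

namespace FirstOrder.Language

variable {L : Language.{u, v}}

/-! ### Morley sequences supplied by bi-invariance, and consistency along them. -/

section Sequences

variable {𝕆 : Type w} [L.Structure 𝕆] {α : Type} {A B : Set 𝕆} {W : Ultrafilter (α → 𝕆)}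

/-- The first `k` terms of a sequence, in reverse order. -/
def revPrefix {X : Type*} (e : ℕ → X) : ℕ → List X
  | 0 => []
  | k + 1 => e k :: revPrefix e k

theorem revPrefix_length {X : Type*} (e : ℕ → X) (k : ℕ) : (revPrefix e k).length = k := by
  induction k with
  | zero => rfl
  | succ k ih => simp [revPrefix, ih]

theorem listCoords_revPrefix (e : ℕ → α → 𝕆) (k : ℕ) :
    listCoords (revPrefix e k) = ⋃ j < k, Set.range (e j) := by
  induction k with
  | zero => simp [revPrefix, listCoords_nil]
  | succ k ih => rw [revPrefix, listCoords_cons, ih, Set.biUnion_lt_succ, Set.union_comm]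

theorem morleyList_revPrefix {e : ℕ → α → 𝕆} {k : ℕ}
    (h : ∀ i < k, UltraRealizes L W (A ∪ ⋃ j < i, Set.range (e j)) (e i)) :
    MorleyList L W A (revPrefix e k) := by
  induction k with
  | zero => trivial
  | succ k ih =>
    refine ⟨?_, ih fun i hi => h i (hi.trans k.lt_succ_self)⟩
    rw [listCoords_revPrefix]
    exact h k k.lt_succ_self

theorem padList_revPrefix (o : 𝕆) (e : ℕ → α → 𝕆) (k i : ℕ) (hi : i < k) (j : α) :
    padList o (revPrefix e k) (k - 1 - i, j) = e i j := by
  induction k with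
  | zero => omega
  | succ k ih =>
    rcases Nat.lt_succ_iff_lt_or_eq.1 hi with h | rfl
    · have : k + 1 - 1 - i = (k - 1 - i) + 1 := by omega
      rw [this]
      exact ih h
    · have : i + 1 - 1 - i = 0 := by omega
      rw [this]
      rfl

theorem exists_morley_sequence [Nonempty 𝕆] {κ : Cardinal.{w}} (hκ : ℵ₀ ≤ κ)
    (h𝕆 : L.IsSaturated κ 𝕆) (hA : #A < κ) {n : ℕ} (W : Ultrafilter (Fin n → 𝕆)) (k : ℕ) :
    ∃ e : ℕ → Fin n → 𝕆, ∀ i < k, UltraRealizes L W (A ∪ ⋃ j < i, Set.range (e j)) (e i) := by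
  induction k with
  | zero => exact ⟨fun _ _ => Classical.arbitrary 𝕆, by simp⟩
  | succ k ih =>
    obtain ⟨e, he⟩ := ih
    obtain ⟨x, hx⟩ := h𝕆.exists_realization
      (mk_union_finite_lt hκ hA (listCoords_finite (revPrefix e k))) W
    rw [listCoords_revPrefix] at hx
    have hU : ∀ i ≤ k, (⋃ j < i, Set.range (Function.update e k x j)) =
        ⋃ j < i, Set.range (e j) := by
      intro i hi
      refine Set.iUnion₂_congr fun j hj => ?_
      rw [Function.update_of_ne (by omega)]
    refine ⟨Function.update e k x, fun i hi => ?_⟩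
    rw [hU i (Nat.lt_succ_iff.1 hi)]
    rcases Nat.lt_succ_iff_lt_or_eq.1 hi with h | rfl
    · rw [Function.update_of_ne h.ne]
      exact he i h
    · rw [Function.update_self]
      exact hx

variable {n : ℕ} {p : GlobalType L 𝕆 (Fin n)} {W : Ultrafilter (Fin n → 𝕆)}

theorem GlobalType.exists_ultraInvariant_realizes [Nonempty 𝕆] {k : ℕ}
    {b : Fin k → 𝕆} (h : ∃ r : GlobalType L 𝕆 (Fin k), r.IsInvariant A ∧ r.RealizedOver B b) :
    ∃ r : Ultrafilter (Fin k → 𝕆), UltraInvariant L A r ∧ UltraRealizes L r B b := by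
  obtain ⟨r, hr, hb⟩ := h
  obtain ⟨R, hR⟩ := r.exists_ultrafilter
  exact ⟨R, hr.ultraInvariant hR, (r.realizedOver_iff hR).1 hb⟩

theorem GlobalType.IsBiInvariant.exists_morleyList [Nonempty 𝕆] {κ : Cardinal.{w}} (hκ : ℵ₀ ≤ κ)
    (h𝕆 : L.IsSaturated κ 𝕆) (hA : #A < κ) (hp : p.IsBiInvariant A)
    (hW : ∀ (k : ℕ) (ψ : L.Formula (Fin n ⊕ Fin k)) (d : Fin k → 𝕆),
      p.Holds ψ d ↔ {x | ψ.Realize (Sum.elim x d)} ∈ W) (k : ℕ) (b : Fin k → 𝕆) :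
    ∃ E : List (Fin n → 𝕆), E.length = 1 ∧ MorleyList L W (A ∪ Set.range b) E ∧
      ∃ r : Ultrafilter (Fin k → 𝕆), UltraInvariant L A r ∧
        UltraRealizes L r (A ∪ listCoords E) b := by
  obtain ⟨e, he⟩ := h𝕆.exists_realization (mk_union_finite_lt hκ hA (Set.finite_range b)) W
  refine ⟨[e], rfl, ⟨?_, trivial⟩, ?_⟩
  · rw [listCoords_nil, Set.union_empty]
    exact he
  · rw [listCoords_cons, listCoords_nil, Set.union_empty]
    exact exists_ultraInvariant_realizes (hp.2 e k b ((p.realizedOver_iff hW).2 he))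

/-- `IsPower` only asks for some Morley sequence satisfying the formula; invariance gives all those
of the same length the same type, so the given one satisfies it too. -/
theorem GlobalType.IsPower.realizedOver {s : ℕ} {r : GlobalType L 𝕆 (Fin s × Fin n)} {o : 𝕆}
    (ho : o ∈ A) (hr : r.IsPower p A) (hpA : UltraInvariant L A W)
    (hW : ∀ (k : ℕ) (ψ : L.Formula (Fin n ⊕ Fin k)) (d : Fin k → 𝕆),
      p.Holds ψ d ↔ {x | ψ.Realize (Sum.elim x d)} ∈ W) (hAB : A ⊆ B) {e : ℕ → Fin n → 𝕆}
    (he : ∀ i < s, UltraRealizes L W (B ∪ ⋃ j < i, Set.range (e j)) (e i)) :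
    r.RealizedOver B fun ij => e ij.1 ij.2 := by
  have hlt : ∀ (i : Fin s) (f : ℕ → Fin n → 𝕆),
      (⋃ j < i, Set.range (f j)) = ⋃ j < (i : ℕ), Set.range (f j) := by
    intro i f
    ext y
    simp only [Set.mem_iUnion]
    exact ⟨fun ⟨j, hj, hy⟩ => ⟨j, hj, hy⟩, fun ⟨j, hj, hy⟩ => ⟨⟨j, hj.trans i.2⟩, hj, hy⟩⟩
  intro k ψ d hd
  have hAd : A ∪ Set.range d ⊆ B := Set.union_subset hAB (by rintro _ ⟨i, rfl⟩; exact hd i)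
  refine (hr k ψ d).trans ⟨?_, fun h => ⟨fun i => e i, fun i => ?_, h⟩⟩
  · rintro ⟨a, ha, hψ⟩
    let f : ℕ → Fin n → 𝕆 := fun i => if h : i < s then a ⟨i, h⟩ else fun _ => o
    have hfa : ∀ i : Fin s, f i = a i := fun i => dif_pos i.2
    have hf : ∀ i < s, UltraRealizes L W (A ∪ Set.range d ∪ ⋃ j < i, Set.range (f j)) (f i) := by
      intro i hi
      have h1 := (p.realizedOver_iff hW).1 (ha ⟨i, hi⟩)
      have h2 := hlt ⟨i, hi⟩ f
      simp only [hfa] at h2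
      rw [h2] at h1
      rw [← hfa ⟨i, hi⟩] at h1
      exact h1
    have hs : SameType L (A ∪ Set.range d) (padList o (revPrefix f s)) (padList o (revPrefix e s)) :=
      (morleyList_revPrefix hf).sameType (hpA.mono Set.subset_union_left) (Or.inl ho)
        ((morleyList_revPrefix he).mono hAd) (by rw [revPrefix_length, revPrefix_length])
    -- `revPrefix` puts the latest term first, so term `i` stands at position `s - 1 - i`.
    have hs' := hs.comp fun ij : Fin s × Fin n => (s - 1 - (ij.1 : ℕ), ij.2)
    have hrow : ∀ g : ℕ → Fin n → 𝕆, padList o (revPrefix g s) ∘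
        (fun ij : Fin s × Fin n => (s - 1 - (ij.1 : ℕ), ij.2)) = fun ij => g ij.1 ij.2 := by
      intro g
      funext ij
      exact padList_revPrefix o g s ij.1 ij.1.2 ij.2
    rw [hrow, hrow] at hs'
    simp only [hfa] at hs'
    exact (hs' _ (definable_formula ψ fun j => Or.inr ⟨j, rfl⟩)).1 hψ
  · refine (p.realizedOver_iff hW).2 ?_
    rw [hlt i e]
    exact (he i i.2).mono (Set.union_subset_union_left _ hAd)

theorem GlobalType.IsStronglyBiInvariant.exists_morleyList [Nonempty 𝕆] {κ : Cardinal.{w}}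
    (hκ : ℵ₀ ≤ κ) (h𝕆 : L.IsSaturated κ 𝕆) (hA : #A < κ) {o : 𝕆} (ho : o ∈ A)
    (hp : p.IsStronglyBiInvariant A)
    (hW : ∀ (k : ℕ) (ψ : L.Formula (Fin n ⊕ Fin k)) (d : Fin k → 𝕆),
      p.Holds ψ d ↔ {x | ψ.Realize (Sum.elim x d)} ∈ W) (s k : ℕ) (b : Fin k → 𝕆) :
    ∃ E : List (Fin n → 𝕆), E.length = s ∧ MorleyList L W (A ∪ Set.range b) E ∧
      ∃ r : Ultrafilter (Fin k → 𝕆), UltraInvariant L A r ∧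
        UltraRealizes L r (A ∪ listCoords E) b := by
  obtain ⟨e, he⟩ := exists_morley_sequence hκ h𝕆
    (mk_union_finite_lt hκ hA (Set.finite_range b)) W s
  obtain ⟨q, hq, hqA⟩ := hp.2 s
  refine ⟨revPrefix e s, revPrefix_length e s, morleyList_revPrefix he, ?_⟩
  have h1 := hq.realizedOver ho (hp.1.ultraInvariant hW) hW Set.subset_union_left he
  obtain ⟨r, hr, hrb⟩ := exists_ultraInvariant_realizes (hqA.2 _ k b h1)
  refine ⟨r, hr, hrb.mono (Set.union_subset_union_right _ ?_)⟩
  rw [listCoords_revPrefix]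
  rintro y hy
  obtain ⟨i, hi, j, rfl⟩ := Set.mem_iUnion₂.1 hy
  exact ⟨(⟨i, hi⟩, j), rfl⟩

theorem exists_forall_mem_iff_padList {β : Type} (o : 𝕆) (φ : L.Formula (β ⊕ α))
    (l : List (α → 𝕆)) :
    (∃ x : β → 𝕆, ∀ i ∈ Finset.range l.length,
        φ.Realize (Sum.elim x fun j => padList o l (i, j))) ↔
      ∃ x : β → 𝕆, ∀ e ∈ l, φ.Realize (Sum.elim x e) := by
  refine exists_congr fun x => ⟨fun h e he => ?_, fun h i hi => ?_⟩
  · obtain ⟨i, hi, rfl⟩ := List.getElem_of_mem he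
    have := h i (Finset.mem_range.2 hi)
    rwa [funext fun j => padList_get o l i hi j] at this
  · have hi := Finset.mem_range.1 hi
    rw [funext fun j => padList_get o l i hi j]
    exact h _ (List.getElem_mem hi)

theorem definable_padList_consistent {β : Type} [Finite β] (φ : L.Formula (β ⊕ α)) (k : ℕ) :
    A.Definable L {y : ℕ × α → 𝕆 | ∃ x : β → 𝕆, ∀ i ∈ Finset.range k,
      φ.Realize (Sum.elim x fun j => y (i, j))} := by
  refine (Set.empty_definable_iff.2 ⟨consistencyFormula φ (Finset.range k), ?_⟩).mono
    (Set.empty_subset A)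
  ext y
  exact (realize_consistencyFormula φ _ y).symm

/-- If `φ(x, y)` does not `p`-Kim-divide, then it is consistent on all finite Morley sequences. -/
theorem GlobalType.exists_realize_of_not_kimDivides {β : Type} [Finite β] {o : 𝕆} (ho : o ∈ A)
    (hpA : UltraInvariant L A W)
    (hW : ∀ (k : ℕ) (ψ : L.Formula (Fin n ⊕ Fin k)) (d : Fin k → 𝕆),
      p.Holds ψ d ↔ {x | ψ.Realize (Sum.elim x d)} ∈ W) {φ : L.Formula (β ⊕ Fin n)}
    (hφ : ¬ p.KimDivides A φ) {l : List (Fin n → 𝕆)} (hl : MorleyList L W A l) :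
    ∃ x : β → 𝕆, ∀ e ∈ l, φ.Realize (Sum.elim x e) := by
  unfold KimDivides at hφ
  push Not at hφ
  obtain ⟨e, he, hcons⟩ := hφ
  have hm : MorleyList L W A (revPrefix e l.length) :=
    morleyList_revPrefix fun i _ => (p.realizedOver_iff hW).1 (he i)
  have hlen := revPrefix_length e l.length
  refine (exists_forall_mem_iff_padList o φ l).1 ?_
  refine (hm.sameType hpA ho hl hlen _ (definable_padList_consistent φ l.length)).1 ?_
  have := (exists_forall_mem_iff_padList o φ (revPrefix e l.length)).2 ?_
  · rw [hlen] at this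
    exact this
  obtain ⟨x, hx⟩ := hcons (Finset.range l.length) (by simp)
  refine ⟨x, fun y hy => ?_⟩
  have hy' : ∀ k, y ∈ revPrefix e k → ∃ i < k, y = e i := by
    intro k
    induction k with
    | zero => simp [revPrefix]
    | succ k ih =>
      intro h
      rcases List.mem_cons.1 h with rfl | h
      · exact ⟨k, k.lt_succ_self, rfl⟩
      · obtain ⟨i, hi, h⟩ := ih h
        exact ⟨i, hi.trans k.lt_succ_self, h⟩
  obtain ⟨i, hi, rfl⟩ := hy' _ hy
  exact hx i (Finset.mem_range.2 hi)

end Sequences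

end FirstOrder.Language

namespace FirstOrder.Language

variable {L : Language.{u, v}}

/-! ### Inconsistency from the dual type, and assembly of the tree. -/

section DualType

variable {𝕆 : Type w} [L.Structure 𝕆] {m : ℕ}

/-- The tuples `c` from `M` such that `φ(x, c) ∈ Γ`. -/
def dualTypeParams {M : L.ElementarySubstructure 𝕆} (Γ : Set (L[[M]].Formula (Fin m))) (n : ℕ)
    (φ : L.Formula (Fin m ⊕ Fin n)) : Set (Fin n → 𝕆) :=
  {c | ∃ c' : Fin n → M, (∀ j, (c' j : 𝕆) = c j) ∧ φ.plug c' ∈ Γ}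

/-- Lists approximated by members of a dual type are `k`-inconsistent. -/
theorem IsDualType.exists_forall_not_realize [Nonempty 𝕆] {M : L.ElementarySubstructure 𝕆}
    {Γ : Set (L[[M]].Formula (Fin m))} (hΓ : IsDualType Γ) :
    ∃ k : ℕ, ∀ (n : ℕ) (φ : L.Formula (Fin m ⊕ Fin n)) (j₀ : Fin n),
      Sum.inr j₀ ∈ BoundedFormula.freeVarFinset φ → ∀ (A : Set 𝕆) (P : Set (Fin n → 𝕆)) (o : 𝕆),
      P ⊆ dualTypeParams Γ n φ → ∀ l : List (Fin n → 𝕆), l.length = k →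
      ApproxBy L A P j₀ o l → ¬ ∃ x : Fin m → 𝕆, ∀ e ∈ l, φ.Realize (Sum.elim x e) := by
  classical
  obtain ⟨k, hk⟩ := hΓ
  refine ⟨k, ?_⟩
  rintro n φ j₀ hj₀ A P o hP l rfl hl hx
  obtain ⟨l', hlen, hl'P, hpw, hl'⟩ := hl _ (definable_padList_consistent φ l.length)
    ((exists_forall_mem_iff_padList o φ l).2 hx)
  have hc : ∀ i : Fin l'.length, ∃ c' : Fin n → M, (∀ j, (c' j : 𝕆) = l'[i] j) ∧
      φ.plug c' ∈ Γ := fun i => hP (hl'P _ (List.getElem_mem i.2))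
  choose c hc hcΓ using hc
  have hinj : Function.Injective fun i => φ.plug (c i) := by
    intro i i' h
    by_contra hne
    have h1 := Formula.eq_of_plug_eq h hj₀
    have h2 : l'[i] j₀ = l'[i'] j₀ := by rw [← hc, ← hc, h1]
    have h3 := List.pairwise_iff_getElem.1 hpw
    rcases lt_or_gt_of_ne (Fin.val_ne_of_ne hne) with h | h
    · exact h3 i i' i.2 i'.2 h h2
    · exact h3 i' i i'.2 i.2 h h2.symm
  refine hk (Finset.univ.image fun i => φ.plug (c i)) ?_ ?_ ?_
  · intro θ hθ
    obtain ⟨i, -, rfl⟩ := Finset.mem_image.1 (Finset.mem_coe.1 hθ)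
    exact hcΓ i
  · rw [Finset.card_image_of_injective _ hinj, Finset.card_univ, Fintype.card_fin, hlen]
  · obtain ⟨x, hx⟩ := hl'
    have h𝕆 : (consistencyFormula φ (Finset.univ : Finset (Fin l'.length))).Realize
        (M.subtype ∘ fun ij : Fin l'.length × Fin n => c ij.1 ij.2) := by
      refine (realize_consistencyFormula φ _ _).2 ⟨x, fun i _ => ?_⟩
      have := hx i (Finset.mem_range.2 (hlen ▸ i.2))
      rw [funext fun j => padList_get o l' i i.2 j] at this
      convert! this using 2
      exact funext fun j => hc i j
    -- The common solution lies in `𝕆`, while `Γ` is a dual type over `M`; elementarity provides a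
    -- solution in `M`.
    obtain ⟨y, hy⟩ := (realize_consistencyFormula φ _ _).1 ((M.subtype.map_formula _ _).1 h𝕆)
    refine ⟨y, fun θ hθ => ?_⟩
    obtain ⟨i, -, rfl⟩ := Finset.mem_image.1 hθ
    exact (Formula.realize_plug φ (c i) y).2 (hy i (Finset.mem_univ i))

/-- An ultrafilter on `P` which extends the type of `c` over `A`. -/
theorem exists_coheir_ultrafilter {n : ℕ} {A : Set 𝕆} {P : Set (Fin n → 𝕆)} {c : Fin n → 𝕆}
    (h : ∀ s, A.Definable L s → c ∈ s → ∃ x ∈ P, x ∈ s) :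
    ∃ V : Ultrafilter (Fin n → 𝕆), P ∈ V ∧ ∀ s, A.Definable L s → c ∈ s → s ∈ V := by
  let F : Filter (Fin n → 𝕆) :=
    { sets := {t | ∃ s, A.Definable L s ∧ c ∈ s ∧ P ∩ s ⊆ t}
      univ_sets := ⟨Set.univ, Set.definable_univ, trivial, Set.subset_univ _⟩
      sets_of_superset := fun ⟨s, hs, hc, hst⟩ htt => ⟨s, hs, hc, hst.trans htt⟩
      inter_sets := fun ⟨s, hs, hc, hst⟩ ⟨s', hs', hc', hst'⟩ =>
        ⟨s ∩ s', hs.inter hs', ⟨hc, hc'⟩, fun x hx => ⟨hst ⟨hx.1, hx.2.1⟩, hst' ⟨hx.1, hx.2.2⟩⟩⟩ }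
  have hF : F.NeBot := by
    refine ⟨fun hF => ?_⟩
    obtain ⟨s, hs, hc, hst⟩ := (Filter.empty_mem_iff_bot.2 hF : (∅ : Set (Fin n → 𝕆)) ∈ F)
    obtain ⟨x, hxP, hxs⟩ := h s hs hc
    exact hst ⟨hxP, hxs⟩
  exact ⟨Ultrafilter.of F,
    Ultrafilter.of_le F ⟨Set.univ, Set.definable_univ, trivial, Set.inter_subset_left⟩,
    fun s hs hc => Ultrafilter.of_le F ⟨s, hs, hc, Set.inter_subset_right⟩⟩

theorem exists_tree_model {T : L.Theory} [Nonempty 𝕆] [𝕆 ⊨ T] {κ : Cardinal.{w}} (hκ : ℵ₀ ≤ κ)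
    (h𝕆 : L.IsSaturated κ 𝕆) {M N : L.ElementarySubstructure 𝕆} (hN : #(N : Set 𝕆) < κ)
    {Γ : Set (L[[M]].Formula (Fin m))} (hΓ : IsDualType Γ) {Q : ℕ → Prop} {n : ℕ}
    {φ : L.Formula (Fin m ⊕ Fin n)} {c : Fin n → 𝕆} {j₀ : Fin n}
    (hj₀ : Sum.inr j₀ ∈ BoundedFormula.freeVarFinset φ) (hcj₀ : c j₀ ∉ N)
    (hclosed : ∀ s, (N : Set 𝕆).Definable L s → c ∈ s →
      ∃ x ∈ dualTypeParams Γ n φ, x ∈ s ∧ ∀ j, x j ∈ N)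
    {p : GlobalType L 𝕆 (Fin n)} (hp : p.IsInvariant N) (hpc : p.RealizedOver N c)
    (hφ : ¬ p.KimDivides N φ)
    (hbi : ∀ W : Ultrafilter (Fin n → 𝕆), (∀ (k : ℕ) (ψ : L.Formula (Fin n ⊕ Fin k))
        (d : Fin k → 𝕆), p.Holds ψ d ↔ {x | ψ.Realize (Sum.elim x d)} ∈ W) →
      ∀ t : ℕ, ∃ s : ℕ, (∀ i ≤ t, Q i → i ≤ s) ∧ ∀ (k : ℕ) (b : Fin k → 𝕆),
        ∃ E : List (Fin n → 𝕆), E.length = s ∧ MorleyList L W (N ∪ Set.range b) E ∧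
          ∃ r : Ultrafilter (Fin k → 𝕆), UltraInvariant L (N : Set 𝕆) r ∧
            UltraRealizes L r (N ∪ listCoords E) b) :
    ∃ (k : ℕ) (𝓜 : Theory.ModelType.{u, v, max u v} T) (b : List Bool → Fin n → 𝓜),
      (∀ η : ℕ → Bool, IsKInconsistent φ (fun i => b (pathRestrict η i)) k) ∧
        ∀ l, CombList Q l → ∃ x : Fin m → 𝓜, ∀ σ ∈ l, φ.Realize (Sum.elim x (b σ)) := by
  classical
  obtain ⟨k, hk⟩ := hΓ.exists_forall_not_realize
  obtain ⟨W, hW⟩ := p.exists_ultrafilter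
  have hpN := hp.ultraInvariant hW
  have hWc := (p.realizedOver_iff hW).1 hpc
  obtain ⟨o, ho⟩ : (N : Set 𝕆).Nonempty := ⟨_, (Classical.arbitrary N).2⟩
  let P : Set (Fin n → 𝕆) := {x | x ∈ dualTypeParams Γ n φ ∧ ∀ j, x j ∈ N}
  obtain ⟨V, hPV, hcV⟩ := exists_coheir_ultrafilter (A := (N : Set 𝕆)) (P := P) (c := c)
    fun s hs hcs => by
      obtain ⟨x, hx, hxs, hxN⟩ := hclosed s hs hcs
      exact ⟨x, ⟨hx, hxN⟩, hxs⟩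
  -- For `a ∈ N` this belongs to `tp(c/N)`, as `c j₀ ∉ N`; for `a ∉ N` it holds on all of `P`, whose
  -- tuples come from `N`.
  have hV : ∀ a, {x : Fin n → 𝕆 | x j₀ ≠ a} ∈ V := by
    intro a
    by_cases ha : a ∈ N
    · refine hcV _ (Set.Definable.compl (s := {x : Fin n → 𝕆 | x j₀ = a}) ?_)
        fun h => hcj₀ (h ▸ ha)
      exact definable_formula (α := Fin n) (ι := Unit) (Term.equal (Term.var (Sum.inl j₀))
        (Term.var (Sum.inr ())) : L.Formula (Fin n ⊕ Unit)) (d := fun _ => a) fun _ => ha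
    · exact Filter.mem_of_superset hPV fun x hx h => ha (h ▸ hx.2 j₀)
  let X : ℕ → Set (Finset (List Bool)) := fun d =>
    {F | ∃ l, CombList Q l ∧ (∀ σ ∈ l, σ.length < d) ∧ F = l.toFinset}
  let Y : ℕ → Set (Finset (List Bool)) := fun d =>
    {F | ∃ l, ChainList l ∧ (∀ σ ∈ l, σ.length < d) ∧ l.length = k ∧ F = l.toFinset}
  obtain ⟨𝓜, b, hb⟩ := exists_model_of_finite_trees (T := T) (𝕆 := 𝕆) φ X Y
    (fun d d' hd F ⟨l, h, h', h''⟩ => ⟨l, h, fun σ hσ => (h' σ hσ).trans_le hd, h''⟩)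
    (fun d d' hd F ⟨l, h, h', h''⟩ => ⟨l, h, fun σ hσ => (h' σ hσ).trans_le hd, h''⟩) (by
      intro d
      obtain ⟨f, hf, hf'⟩ := exists_tree hκ h𝕆 hN ho hpN
        (fun s hs hsW => hcV s hs (hWc s hs hsW)) hPV (fun x hx => hx.2) hV (hbi W hW) d
      refine ⟨f, ?_, ?_⟩
      · rintro _ ⟨l, hl, hd, rfl⟩
        obtain ⟨x, hx⟩ := p.exists_realize_of_not_kimDivides ho hpN hW hφ (hf l hl hd)
        exact ⟨x, fun σ hσ => hx _ (List.mem_map_of_mem (List.mem_toFinset.1 hσ))⟩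
      · rintro _ ⟨l, hl, hd, hlk, rfl⟩ ⟨x, hx⟩
        refine hk n φ j₀ hj₀ N P o (fun x hx => hx.1) (l.map f) (by rwa [List.length_map])
          (hf' l hl hd) ⟨x, fun e he => ?_⟩
        obtain ⟨σ, hσ, rfl⟩ := List.mem_map.1 he
        exact hx σ (List.mem_toFinset.2 hσ))
  have hbound : ∀ l : List (List Bool), ∃ d, ∀ σ ∈ l, σ.length < d := by
    intro l
    induction l with
    | nil => exact ⟨0, by simp⟩
    | cons σ l ih =>
      obtain ⟨d, hd⟩ := ih
      refine ⟨max d (σ.length + 1), fun τ hτ => ?_⟩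
      rcases List.mem_cons.1 hτ with rfl | hτ
      · exact (Nat.lt_succ_self _).trans_le (le_max_right _ _)
      · exact (hd τ hτ).trans_le (le_max_left _ _)
  refine ⟨k, 𝓜, b, fun η F hF => ?_, fun l hl => ?_⟩
  · rintro ⟨x, hx⟩
    obtain ⟨d, hd⟩ := hbound ((F.sort (· ≤ ·)).map (pathRestrict η))
    refine (hb d).2 _ ⟨_, ChainList.map_pathRestrict (F.sup id + 1) η (F.sort (· ≤ ·))
      (Finset.sortedLT_sort F).pairwise (fun i hi => ?_), hd, ?_, rfl⟩ ⟨x, fun σ hσ => ?_⟩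
    · exact Nat.lt_succ_of_le (Finset.le_sup (f := id) ((Finset.mem_sort _).1 hi))
    · rw [List.length_map, Finset.length_sort, hF]
    · obtain ⟨i, hi, rfl⟩ := List.mem_map.1 (List.mem_toFinset.1 hσ)
      exact hx i ((Finset.mem_sort _).1 hi)
  · obtain ⟨d, hd⟩ := hbound l
    obtain ⟨x, hx⟩ := (hb d).1 _ ⟨l, hl, hd, rfl⟩
    exact ⟨x, fun σ hσ => hx σ (List.mem_toFinset.2 hσ)⟩

theorem IsClubOfSmall.exists_closed_dualType {κ : Cardinal.{w}} (hκ : ℵ₀ < κ)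
    (hL : Cardinal.lift.{w} L.card < Cardinal.lift.{max u v} κ) {M : L.ElementarySubstructure 𝕆}
    {C : Set (L.ElementarySubstructure 𝕆)} (hC : IsClubOfSmall κ M C)
    (Γ : Set (L[[M]].Formula (Fin m))) :
    ∃ N ∈ C, ∀ (n : ℕ) (φ : L.Formula (Fin m ⊕ Fin n)) (c : Fin n → M), φ.plug c ∈ Γ →
      ∀ s, (N : Set 𝕆).Definable L s → (fun j => (c j : 𝕆)) ∈ s →
        ∃ x ∈ dualTypeParams Γ n φ, x ∈ s ∧ ∀ j, x j ∈ N := by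
  obtain ⟨N, hN, h⟩ := hC.exists_closed hκ hL (dualTypeParams Γ) fun n φ c ⟨c', hc', _⟩ j =>
    hc' j ▸ (c' j).2
  exact ⟨N, hN, fun n φ c hc s hs hcs => h n φ s hs ⟨_, ⟨c, fun _ => rfl, hc⟩, hcs⟩⟩

end DualType

end FirstOrder.Language

/-! ### The theorem. -/

theorem mainTheorem7 {L : FirstOrder.Language.{u, v}} (T : L.Theory) (hT : T.IsComplete)
    -- `κ > |T|` is a measurable cardinal
    (κ : Cardinal.{w}) (hκ : κ.IsMeasurable)
    (hTκ : Cardinal.lift.{w} L.card < Cardinal.lift.{max u v} κ)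
    -- `𝕆` is a monster model of `T`, in which `M` (of cardinality `κ`) is small
    (𝕆 : Type w) [L.Structure 𝕆] [Nonempty 𝕆] [𝕆 ⊨ T]
    (h𝕆 : L.IsSaturated (Order.succ κ) 𝕆)
    -- `M` is the saturated model of `T` of cardinality `κ`
    (M : L.ElementarySubstructure 𝕆) (hMκ : #M = κ) (hM : L.IsSaturated κ M)
    -- `Γ` is a dual type over `M` of cardinality `κ`
    (m : ℕ) (Γ : Set (L[[M]].Formula (Fin m))) (hΓ : FirstOrder.Language.IsDualType Γ)
    (hΓκ : #Γ = Cardinal.lift.{max u v} κ)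
    -- `C` is a club of small elementary substructures of `M`
    (C : Set (L.ElementarySubstructure 𝕆)) (hC : FirstOrder.Language.IsClubOfSmall κ M C) :
    ((∀ N ∈ C, ∃ (n : ℕ) (φ : L.Formula (Fin m ⊕ Fin n)) (c : Fin n → M)
        (p : L.GlobalType 𝕆 (Fin n)),
        φ.plug c ∈ Γ ∧
        (∃ j, Sum.inr j ∈ FirstOrder.Language.BoundedFormula.freeVarFinset φ ∧ (c j : 𝕆) ∉ N) ∧
        p.IsInvariant N ∧ p.RealizedOver N (fun j => (c j : 𝕆)) ∧
        ¬ p.KimDivides N φ ∧ p.IsBiInvariant N) →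
      T.HasCTP) ∧
    ((∀ N ∈ C, ∃ (n : ℕ) (φ : L.Formula (Fin m ⊕ Fin n)) (c : Fin n → M)
        (p : L.GlobalType 𝕆 (Fin n)),
        φ.plug c ∈ Γ ∧
        (∃ j, Sum.inr j ∈ FirstOrder.Language.BoundedFormula.freeVarFinset φ ∧ (c j : 𝕆) ∉ N) ∧
        p.IsInvariant N ∧ p.RealizedOver N (fun j => (c j : 𝕆)) ∧
        ¬ p.KimDivides N φ ∧ p.IsStronglyBiInvariant N) →
      T.HasATP) ∧
    (¬ T.HasATP →
      ∃ N ∈ C, ∀ (n : ℕ) (φ : L.Formula (Fin m ⊕ Fin n)) (c : Fin n → M)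
        (p : L.GlobalType 𝕆 (Fin n)),
        φ.plug c ∈ Γ →
        (∃ j, Sum.inr j ∈ FirstOrder.Language.BoundedFormula.freeVarFinset φ ∧ (c j : 𝕆) ∉ N) →
        p.RealizedOver N (fun j => (c j : 𝕆)) → p.IsStronglyBiInvariant N →
        p.KimDivides N φ) := by

  classical
  have hκ0 : ℵ₀ < κ := hκ.1
  have hκs : ℵ₀ ≤ Order.succ κ := hκ0.le.trans (Order.le_succ κ)
  have hsmall : ∀ N ∈ C, #(N : Set 𝕆) < Order.succ κ := fun N hN =>
    (hC.small N hN).trans (Order.lt_succ κ)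
  obtain ⟨N, hN, hclosed⟩ := hC.exists_closed_dualType hκ0 hTκ Γ
  have hATP : (∀ N ∈ C, ∃ (n : ℕ) (φ : L.Formula (Fin m ⊕ Fin n)) (c : Fin n → M)
        (p : L.GlobalType 𝕆 (Fin n)),
        φ.plug c ∈ Γ ∧
        (∃ j, Sum.inr j ∈ FirstOrder.Language.BoundedFormula.freeVarFinset φ ∧ (c j : 𝕆) ∉ N) ∧
        p.IsInvariant N ∧ p.RealizedOver N (fun j => (c j : 𝕆)) ∧
        ¬ p.KimDivides N φ ∧ p.IsStronglyBiInvariant N) →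
      T.HasATP := by
    intro h
    obtain ⟨n, φ, c, p, hcΓ, ⟨j₀, hj₀, hcj₀⟩, hp, hpc, hφ, hbi⟩ := h N hN
    obtain ⟨k, 𝓜, b, hb, hb'⟩ := FirstOrder.Language.exists_tree_model (T := T)
      (Q := fun _ => True) hκs h𝕆 (hsmall N hN) hΓ hj₀ hcj₀ (hclosed n φ c hcΓ) hp hpc hφ
      -- For antichains the left part can have any size up to `t`, so Morley sequences of length `t`
      -- are needed.
      fun W hW t => ⟨t, fun i hi _ => hi, fun k b =>
        hbi.exists_morleyList hκs h𝕆 (hsmall N hN) (Classical.arbitrary N).2 hW t k b⟩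
    refine ⟨k, 𝓜, m, n, φ, b, hb, fun X hX F hF => ?_⟩
    obtain ⟨l, hl, hlF⟩ := FirstOrder.Language.CombList.exists_of_isAntichain
      (F.sup List.length + 1) (F : Set (List Bool))
      (fun σ hσ => Nat.lt_succ_of_le (Finset.le_sup (f := List.length) hσ)) (hX.subset hF)
    obtain ⟨x, hx⟩ := hb' l hl
    exact ⟨x, fun σ hσ => hx σ ((hlF σ).2 hσ)⟩
  refine ⟨fun h => ?_, hATP, fun hT' => ?_⟩
  · obtain ⟨n, φ, c, p, hcΓ, ⟨j₀, hj₀, hcj₀⟩, hp, hpc, hφ, hbi⟩ := h N hN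
    obtain ⟨k, 𝓜, b, hb, hb'⟩ := FirstOrder.Language.exists_tree_model (T := T)
      (Q := (· ≤ 1)) hκs h𝕆 (hsmall N hN) hΓ hj₀ hcj₀ (hclosed n φ c hcΓ) hp hpc hφ
      -- For right-combs at most one element branches off to the left, so length `1` is enough.
      fun W hW t => ⟨1, fun i _ hi => hi, fun k b =>
        hbi.exists_morleyList hκs h𝕆 (hsmall N hN) hW k b⟩
    refine ⟨k, 𝓜, m, n, φ, b, hb, fun X hX F hF => ?_⟩
    obtain ⟨l, hl, hlX⟩ := hX.exists_combList []
    obtain ⟨x, hx⟩ := hb' l hl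
    exact ⟨x, fun σ hσ => hx σ ((hlX σ).2 (hF hσ))⟩
  · by_contra hcon
    push Not at hcon
    refine hT' (hATP fun N hN => ?_)
    obtain ⟨n, φ, c, p, h₁, h₂, h₃, h₄, h₅⟩ := hcon N hN
    exact ⟨n, φ, c, p, h₁, h₂, h₄.1, h₃, h₅, h₄⟩
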